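/- **Definitions.** Two polynomials $P,Q\in\mathbb C[x]$ form a *Pell pair* if one of them is an even and the other an odd function and $|P(x)|^2+(1-x^2)|Q(x)|^2=1$ for all $x\in[-1,1]$; then $P$ is *Pellian*. A polynomial in $\mathbb R[x]$ is *semi-Pellian* if it is the real part (coefficientwise) of a Pellian polynomial. Given are a unit vector $|\psi\rangle$ of a complex inner product space and an orthogonal projector $\Pi$; let $a=\|\Pi|\psi\rangle\|$, $Z_\psi=2|\psi\rangle\langle\psi|-I$, $Z_\Pi=2\Pi-I$. Let $|\Pi\rangle,|\Pi^\perp\rangle,|\psi^\perp\rangle$ be the unit vectors proportional to $\Pi|\psi\rangle$, to $(I-\Pi)|\psi\rangle$ and to $(\Pi-a^2)|\psi\rangle$ (those of them that are orthogonal to $|\psi\rangle$ do not occur if $a\in\{0,1\}$). To *sample from a polynomial* $P$ is to run a quantum circuit that, on one of the four states $|\psi\rangle,|\psi^\perp\rangle,|\Pi\rangle,|\Pi^\perp\rangle$ and for every $|\psi\rangle$ and $\Pi$, produces a bit that is $1$ with probability $|P(a)|^2$, leaves the register in one of the four states, identified by a final measurement in the basis $|\psi\rangle,|\psi^\perp\rangle$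 or $|\Pi\rangle,|\Pi^\perp\rangle$, and uses at most $\deg P+3$ queries (the measurement counts as one). The queries are to $e^{i\phi Z_\psi},e^{i\phi Z_\Pi}$ if $P$ is sampled as a Pellian polynomial, and to $e^{i\phi Z_\psi}\oplus e^{-i\phi Z_\psi}$, $e^{i\phi Z_\Pi}\oplus e^{-i\phi Z_\Pi}$, controlled by a flag qubit that is measured as well, if it is sampled as a semi-Pellian one. An *amplitude estimation algorithm* starts with one copy of $|\psi\rangle$ and adaptively samples from Pellian or semi-Pellian polynomials until it outputs a real number $\hat a$; it does not depend on $|\psi\rangle$, $\Pi$ and $a$. Its *total degree* $\mathbf D$ is the sum of the degrees of the polynomials that it samples from. **Theorem (unbiased amplitude estimation).** There is a constant $C>0$ such that for all $\varepsilon,\delta,\eta>0$ there are an amplitude estimation algorithm, which samples from semi-Pellian polynomials only, and a number $D\in\mathbb N$ such that, for every $|\psi\rangle$ and $\Pi$, $$\Pr[|\hat a-a|\ge\varepsilon]\le\delta,\qquad |\mathbb E[\hat a]-a|\le\varepsilon\eta+\delta,\qquad \mathbf D=D\ \text{with probability }1,$$ where $$D\le C\,\varepsilon^{-1}\bigl(\max(\log\delta^{-1},\log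 2)+\eta^{-1}\bigr),$$ and the total number of queries is, with probability $1$, also at most the right-hand side of the last inequality. (For $\delta\le 1/2$ this right-hand side is $C\varepsilon^{-1}(\log\delta^{-1}+\eta^{-1})$.) -/

import Mathlib

open Polynomial MeasureTheory

universe u

namespace AmpEst

/-! ### Pellian and semi-Pellian polynomials -/

/-- A polynomial that is an even function. -/
def IsEvenPoly (P : ℂ[X]) : Prop := ∀ z : ℂ, P.eval (-z) = P.eval z

/-- A polynomial that is an odd function. -/
def IsOddPoly (P : ℂ[X]) : Prop := ∀ z : ℂ, P.eval (-z) = -P.eval z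

/-- `P` and `Q` form a Pell pair: they have fixed and opposite parity and
`|P(x)|² + (1 - x²)|Q(x)|² = 1` on `[-1, 1]`. -/
def FormPellPair (P Q : ℂ[X]) : Prop :=
  ((IsEvenPoly P ∧ IsOddPoly Q) ∨ (IsOddPoly P ∧ IsEvenPoly Q)) ∧
    ∀ x : ℝ, x ∈ Set.Icc (-1 : ℝ) 1 →
      ‖P.eval (x : ℂ)‖ ^ 2 + (1 - x ^ 2) * ‖Q.eval (x : ℂ)‖ ^ 2 = 1

/-- `P` is Pellian if it is the first member of a Pell pair. -/
def IsPellian (P : ℂ[X]) : Prop := ∃ Q : ℂ[X], FormPellPair P Q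

/-- A real polynomial is semi-Pellian if it is the real part of a Pellian polynomial. -/
def IsSemiPellian (p : ℝ[X]) : Prop :=
  ∃ P : ℂ[X], IsPellian P ∧ ∀ n : ℕ, (P.coeff n).re = p.coeff n

/-! ### The input: a state and a projector -/

/-- An input of the amplitude estimation problem: a unit vector `ψ` and an orthogonal
projector `proj` (called `Π` in the comments). -/
structure Instance (H : Type u) [NormedAddCommGroup H] [InnerProductSpace ℂ H] where
  /-- the state -/
  ψ : H
  norm_ψ : ‖ψ‖ = 1
  /-- the projector -/
  proj : H →ₗ[ℂ] H
  isProj : proj.IsSymmetricProjection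

/-- The two oracles: rotations generated by `Z_ψ = 2|ψ⟩⟨ψ| - 1` and by `Z_Π = 2Π - 1`. -/
inductive Axis
  | psi
  | pi

/-- The four states between which a sampling step moves. -/
inductive Label
  | psi
  | psiPerp
  | pi
  | piPerp

section Circuits

variable {H : Type u} [NormedAddCommGroup H] [InnerProductSpace ℂ H]

/-- The amplitude `a = ‖Π ψ‖` that is to be estimated. -/
noncomputable def Instance.amplitude (I : Instance H) : ℝ := ‖I.proj I.ψ‖

/-- The projector `|ψ⟩⟨ψ|`, respectively `Π`, applied to a vector. -/
noncomputable def Instance.axisProj (I : Instance H) : Axis → H → H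
  | Axis.psi, v => (inner ℂ I.ψ v : ℂ) • I.ψ
  | Axis.pi, v => I.proj v

/-- The states `|ψ⟩`, `|ψ^⊥⟩`, `|Π⟩`, `|Π^⊥⟩` up to scalars: `|Π⟩` is proportional to `Πψ`,
`|Π^⊥⟩` to `ψ - Πψ`, and `|ψ^⊥⟩` to `Πψ - a²ψ`. If `a` is `0` or `1`, two of these vectors
vanish (those that are orthogonal to `ψ`); the corresponding states are never reached. -/
noncomputable def Instance.vec (I : Instance H) : Label → H
  | Label.psi => I.ψ
  | Label.psiPerp => I.proj I.ψ - ((I.amplitude : ℂ) ^ 2) • I.ψ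
  | Label.pi => I.proj I.ψ
  | Label.piPerp => I.ψ - I.proj I.ψ

/-- `exp(iφZ) v = e^{iφ} p v + e^{-iφ} (v - p v)` for `Z = 2p - 1`, with `p = |ψ⟩⟨ψ|` or
`p = Π`. -/
noncomputable def Instance.gate (I : Instance H) (x : Axis) (φ : ℝ) (v : H) : H :=
  Complex.exp (φ * Complex.I) • I.axisProj x v +
    Complex.exp (-(φ * Complex.I)) • (v - I.axisProj x v)

/-- A list of rotations applied to `v`, the head of the list first; each angle is multiplied
by the sign `s`. -/
noncomputable def Instance.evolve (I : Instance H) (s : ℝ) : List (Axis × ℝ) → H → H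
  | [], v => v
  | g :: l, v => I.evolve s l (I.gate g.1 (s * g.2) v)

/-- The projective measurement `{p, 1 - p}` with `p = |ψ⟩⟨ψ|` or `p = Π`: the unnormalized
vector that belongs to the outcome `p` (`true`) or `1 - p` (`false`). -/
noncomputable def Instance.measure (I : Instance H) (x : Axis) (o : Bool) (v : H) : H :=
  if o then I.axisProj x v else v - I.axisProj x v

/-- One circuit. If `flagged = false`, the rotations `exp(iφZ)` in `gates` are applied.
If `flagged = true`, a flag qubit is prepared in `|+⟩`, the rotations
`exp(iφZ) ⊕ exp(-iφZ)` in `gates` are applied under its control, then the flag gate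
`e^{iγ} ⊕ e^{-iγ}` (`γ = flagPhase`), then a Hadamard gate on the flag, and the flag is
measured. In both cases the register is finally measured in the basis given by `basis`. The
bit `b` that is sampled is `1` exactly if the register shows the outcome `target` (and the
flag, if there is one, shows `|0⟩`). -/
structure Circuit where
  flagged : Bool
  gates : List (Axis × ℝ)
  flagPhase : ℝ
  basis : Axis
  target : Bool

/-- Number of oracle queries of a circuit: one per rotation and one for the measurement. -/
def Circuit.queries (c : Circuit) : ℕ := c.gates.length + 1

/-- The register (unnormalized) given that the flag shows `|0⟩` (`false`) or `|1⟩` (`true`),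
before the register is measured. Without flag, only `false` occurs. -/
noncomputable def Circuit.flagBranch (c : Circuit) (I : Instance H) (f : Bool) (v : H) : H :=
  if c.flagged then
    (1 / 2 : ℂ) • (Complex.exp (c.flagPhase * Complex.I) • I.evolve 1 c.gates v +
      (if f then (-1 : ℂ) else 1) •
        Complex.exp (-(c.flagPhase * Complex.I)) • I.evolve (-1) c.gates v)
  else
    if f then 0 else I.evolve 1 c.gates v

/-- The unnormalized register after the outcomes `f` of the flag and `o` of the register; by
the Born rule its squared norm, for a unit vector `v`, is the probability of `(f, o)`. -/
noncomputable def Circuit.branch (c : Circuit) (I : Instance H) (f o : Bool) (v : H) : H :=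
  I.measure c.basis o (c.flagBranch I f v)

/-- The state that the register is left in after the outcome `o`. -/
def Circuit.outLabel (c : Circuit) (o : Bool) : Label :=
  match c.basis, o with
  | Axis.psi, true => Label.psi
  | Axis.psi, false => Label.psiPerp
  | Axis.pi, true => Label.pi
  | Axis.pi, false => Label.piPerp

/-- On the input state `s`, and whatever the state and the projector are, the circuit samples
a bit `b` with `Pr[b = 1] = |P(a)|²` and leaves the register in one of the four states, namely
the one that its measurement announces. -/
def Circuit.SamplesFrom (c : Circuit) (P : ℂ[X]) (s : Label) : Prop :=
  ∀ (H : Type u) [NormedAddCommGroup H] [InnerProductSpace ℂ H] (I : Instance H) (v : H),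
    v ∈ Submodule.span ℂ {I.vec s} →
      ‖c.branch I false c.target v‖ ^ 2 = ‖P.eval (I.amplitude : ℂ)‖ ^ 2 * ‖v‖ ^ 2 ∧
      ∀ f o : Bool, c.branch I f o v ∈ Submodule.span ℂ {I.vec (c.outLabel o)}

end Circuits

/-! ### Adaptive algorithms -/

/-- An adaptive procedure: either stop with an estimate, or sample from a polynomial with a
circuit and go on, depending on the outcomes of the flag and of the register. -/
inductive Procedure
  | done (estimate : ℝ) : Procedure
  | sample (P : ℂ[X]) (c : Circuit) (next : Bool → Bool → Procedure) : Procedure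

/-- Every step of the procedure, started in the state `s`, samples from a Pellian polynomial
`P` with the oracles `exp(iφZ)` or from a semi-Pellian polynomial `P` with the oracles
`exp(iφZ) ⊕ exp(-iφZ)`, using at most `deg P + 3` queries. -/
def Procedure.SamplesPolynomialsFrom : Procedure → Label → Prop
  | Procedure.done _, _ => True
  | Procedure.sample P c next, s =>
      (if c.flagged then ∃ p : ℝ[X], IsSemiPellian p ∧ P = p.map (algebraMap ℝ ℂ)
        else IsPellian P) ∧
      c.queries ≤ P.natDegree + 3 ∧
      Circuit.SamplesFrom.{u} c P s ∧
      ∀ f o : Bool, (next f o).SamplesPolynomialsFrom (c.outLabel o)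

/-- An amplitude estimation algorithm: starting with the state `|ψ⟩`, it repeatedly samples
from (Pellian or semi-Pellian) polynomials until it outputs an estimate. -/
def Procedure.IsAmplitudeEstimationAlgorithm (A : Procedure) : Prop :=
  Procedure.SamplesPolynomialsFrom.{u} A Label.psi

/-- All polynomials that are sampled from are sampled as semi-Pellian polynomials. -/
def Procedure.OnlySemiPellian : Procedure → Prop
  | Procedure.done _ => True
  | Procedure.sample _ c next => c.flagged = true ∧ ∀ f o : Bool, (next f o).OnlySemiPellian

/-- What is observed in one execution. -/
structure Outcome where
  /-- the estimate `â` -/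
  estimate : ℝ
  /-- the sum `D` of the degrees of all polynomials that were sampled from -/
  degree : ℕ
  /-- the total number of oracle queries -/
  queries : ℕ

/-- Every set of outcomes is an event; an execution has only finitely many outcomes. -/
instance : MeasurableSpace Outcome := ⊤

section Law

variable {H : Type u} [NormedAddCommGroup H] [InnerProductSpace ℂ H]

/-- The joint law of the outcome when the procedure is continued from the unnormalized
register `v`, after polynomials of total degree `D` were sampled with `Q` queries. The vector
of a path of outcomes has the probability of the path as its squared norm. -/
noncomputable def Procedure.lawFrom (I : Instance H) :
    Procedure → H → ℕ → ℕ → Measure Outcome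
  | Procedure.done r, v, D, Q => ENNReal.ofReal (‖v‖ ^ 2) • Measure.dirac ⟨r, D, Q⟩
  | Procedure.sample P c next, v, D, Q =>
      ∑ f : Bool, ∑ o : Bool,
        (next f o).lawFrom I (c.branch I f o v) (D + P.natDegree) (Q + c.queries)

/-- The joint law of the estimate, the total degree and the number of queries when the
algorithm is run on one copy of `|ψ⟩`. -/
noncomputable def Procedure.law (A : Procedure) (I : Instance H) : Measure Outcome :=
  A.lawFrom I I.ψ 0 0

end Law

end AmpEst

namespace AmpEst

/-! ### Chebyshev polynomials are semi-Pellian -/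

/-! Write a = cos θ with θ in [0, π/2]. In the plane of ψ and Πψ the operators Z_ψ and Z_Π are
reflections, and m alternating ones turn a state so that measuring gives a bit with probability
cos²((m+1)θ) = T_{m+1}(a)². The same holds on each of the four states, so samples can be repeated
without preparing ψ again (`samplesFrom_amplification`, `expect_batch_le`). The Chebyshev
polynomials are real and Pellian, hence semi-Pellian.

The algorithm keeps an interval of length π/(2n) for θ on which cos²(nθ) is monotone. A frequency
that is off by less than 1/8 tells which half, or the middle third, contains θ (`mem_cell_subcell`);
the middle third is what makes a rough estimate suffice. So n doubles or triples, until n ≥ N₂.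

The intervals are nested: if the first wrong decision is made at level n, the output still differs
from a by at most π/(2n). With about √(N₂/n) samples at level n, an error there has probability at
most (n/N₂)² and contributes at most (π/(2N₂))(n/N₂) to the mean absolute error. As n at least
doubles, these contributions and the costs n√(N₂/n) = √(nN₂) sum geometrically. Hence E|â − a| ≤
2π/N₂ ≤ εη for N₂ = (2π/ε) max(1, 1/η), and this bounds the bias. Only errors at levels below N₁ =
π/ε can cause a deviation of ε; about l extra samples on these levels, where l is the maximum of
log(1/δ) and log 2, push their total probability below δ. The estimates are proved by potential
functions on the levels (`expect_search_le`, `costBound_step`). One last sample, whose outcome is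
ignored, makes the total degree deterministic. -/

lemma isPellian_chebyshev (m : ℕ) : IsPellian (Chebyshev.T ℂ ((m + 1 : ℕ) : ℤ)) := by
  refine ⟨Chebyshev.U ℂ (m : ℤ), ?_, fun x hx => ?_⟩
  · rcases Nat.even_or_odd m with h | h
    · have h1 : Odd ((m + 1 : ℕ) : ℤ) := by exact_mod_cast h.add_one
      have h2 : Even (m : ℤ) := by exact_mod_cast h
      refine Or.inr ⟨fun z => ?_, fun z => ?_⟩
      · rw [Chebyshev.T_eval_neg, Int.negOnePow_odd _ h1]; simp
      · rw [Chebyshev.U_eval_neg, Int.negOnePow_even _ h2]; simp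
    · have h1 : Even ((m + 1 : ℕ) : ℤ) := by exact_mod_cast h.add_one
      have h2 : Odd (m : ℤ) := by exact_mod_cast h
      refine Or.inl ⟨fun z => ?_, fun z => ?_⟩
      · rw [Chebyshev.T_eval_neg, Int.negOnePow_even _ h1]; simp
      · rw [Chebyshev.U_eval_neg, Int.negOnePow_odd _ h2]; simp
  · obtain ⟨θ, rfl⟩ : ∃ θ : ℝ, Real.cos θ = x := ⟨Real.arccos x, Real.cos_arccos hx.1 hx.2⟩
    have h1 := Chebyshev.T_real_cos θ ((m + 1 : ℕ) : ℤ)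
    have h2 := Chebyshev.U_real_cos θ (m : ℤ)
    have e1 := Chebyshev.algebraMap_eval_T (R' := ℂ) (Real.cos θ) ((m + 1 : ℕ) : ℤ)
    have e2 := Chebyshev.algebraMap_eval_U (R' := ℂ) (Real.cos θ) (m : ℤ)
    simp only [Complex.coe_algebraMap] at e1 e2
    rw [← e1, ← e2, Complex.norm_real, Complex.norm_real, Real.norm_eq_abs, Real.norm_eq_abs,
      sq_abs, sq_abs, h1, ← Real.sin_sq, ← mul_pow, mul_comm (Real.sin θ), h2]
    push_cast
    exact Real.cos_sq_add_sin_sq _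

lemma isSemiPellian_chebyshev (m : ℕ) : IsSemiPellian (Chebyshev.T ℝ ((m + 1 : ℕ) : ℤ)) := by
  refine ⟨_, isPellian_chebyshev m, fun n => ?_⟩
  rw [← Chebyshev.map_T (algebraMap ℝ ℂ), coeff_map]
  simp

lemma norm_sq_eval_chebyshev (m : ℕ) (θ : ℝ) :
    ‖(Chebyshev.T ℂ (m : ℤ)).eval ((Real.cos θ : ℝ) : ℂ)‖ ^ 2 = Real.cos (m * θ) ^ 2 := by
  have e1 := Chebyshev.algebraMap_eval_T (R' := ℂ) (Real.cos θ) (m : ℤ)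
  simp only [Complex.coe_algebraMap] at e1
  rw [← e1, Chebyshev.T_real_cos, Complex.norm_real, Real.norm_eq_abs, sq_abs]
  simp

/-! ### The two-dimensional picture -/

section Geometry

variable {H : Type u} [NormedAddCommGroup H] [InnerProductSpace ℂ H] (I : Instance H)

lemma Instance.proj_proj (v : H) : I.proj (I.proj v) = I.proj v :=
  congrArg (fun f : H →ₗ[ℂ] H => f v) I.isProj.isIdempotentElem

lemma Instance.inner_self_ψ : inner ℂ I.ψ I.ψ = 1 := by
  rw [inner_self_eq_norm_sq_to_K, I.norm_ψ]; simp

lemma Instance.axisProj_smul (x : Axis) (z : ℂ) (v : H) :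
    I.axisProj x (z • v) = z • I.axisProj x v := by
  cases x
  · rw [Instance.axisProj, inner_smul_right, mul_smul]; rfl
  · simp [Instance.axisProj]

lemma Instance.inner_axisProj_sub (x : Axis) (v : H) :
    inner ℂ (I.axisProj x v) (v - I.axisProj x v) = 0 := by
  cases x
  · rw [Instance.axisProj, inner_smul_left, inner_sub_right, inner_smul_right, I.inner_self_ψ,
      mul_one, sub_self, mul_zero]
  · have := I.isProj.isSymmetric v (v - I.proj v)
    simp only [Instance.axisProj]
    rw [this, map_sub, I.proj_proj, sub_self, inner_zero_right]

lemma norm_sq_add_of_inner_eq_zero {p q : H} (h : inner ℂ p q = 0) :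
    ‖p + q‖ ^ 2 = ‖p‖ ^ 2 + ‖q‖ ^ 2 := by
  have := norm_add_sq_eq_norm_sq_add_norm_sq_of_inner_eq_zero p q h
  simpa [sq] using this

lemma Instance.norm_sq_axisProj_add (x : Axis) (v : H) :
    ‖I.axisProj x v‖ ^ 2 + ‖v - I.axisProj x v‖ ^ 2 = ‖v‖ ^ 2 := by
  rw [← norm_sq_add_of_inner_eq_zero (I.inner_axisProj_sub x v)]; simp

lemma Instance.norm_gate (x : Axis) (φ : ℝ) (v : H) : ‖I.gate x φ v‖ ^ 2 = ‖v‖ ^ 2 := by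
  have h1 : ‖Complex.exp (φ * Complex.I)‖ = 1 := Complex.norm_exp_ofReal_mul_I φ
  have h2 : ‖Complex.exp (-(φ * Complex.I))‖ = 1 := by
    rw [Complex.exp_neg, norm_inv, h1, inv_one]
  rw [Instance.gate, norm_sq_add_of_inner_eq_zero, norm_smul, norm_smul, h1, h2, one_mul, one_mul,
    I.norm_sq_axisProj_add]
  rw [inner_smul_left, inner_smul_right, I.inner_axisProj_sub, mul_zero, mul_zero]

lemma Instance.norm_evolve (s : ℝ) (l : List (Axis × ℝ)) (v : H) :
    ‖I.evolve s l v‖ ^ 2 = ‖v‖ ^ 2 := by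
  induction l generalizing v with
  | nil => rfl
  | cons g l ih => rw [Instance.evolve, ih, I.norm_gate]

/-- The Hadamard gate turns the two controlled branches into half their sum and half their
difference, so this is the parallelogram law. -/
lemma Circuit.sum_norm_sq_flagBranch (c : Circuit) (v : H) :
    ‖c.flagBranch I false v‖ ^ 2 + ‖c.flagBranch I true v‖ ^ 2 = ‖v‖ ^ 2 := by
  unfold Circuit.flagBranch
  by_cases h : c.flagged
  · simp only [h, if_true, Bool.false_eq_true, if_false]
    set p := Complex.exp (c.flagPhase * Complex.I) • I.evolve 1 c.gates v with hp
    set q := Complex.exp (-(c.flagPhase * Complex.I)) • I.evolve (-1) c.gates v with hq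
    have h1 : ‖Complex.exp (c.flagPhase * Complex.I)‖ = 1 := Complex.norm_exp_ofReal_mul_I _
    have h2 : ‖Complex.exp (-(c.flagPhase * Complex.I))‖ = 1 := by
      rw [Complex.exp_neg, norm_inv, h1, inv_one]
    have np : ‖p‖ ^ 2 = ‖v‖ ^ 2 := by rw [hp, norm_smul, h1, one_mul, I.norm_evolve]
    have nq : ‖q‖ ^ 2 = ‖v‖ ^ 2 := by rw [hq, norm_smul, h2, one_mul, I.norm_evolve]
    have par := parallelogram_law_with_norm ℂ p q
    rw [one_smul, neg_one_smul, ← sub_eq_add_neg, norm_smul, norm_smul]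
    norm_num
    nlinarith
  · simp [h, I.norm_evolve]

lemma Circuit.sum_norm_sq_branch (c : Circuit) (v : H) :
    ‖c.branch I false true v‖ ^ 2 + ‖c.branch I false false v‖ ^ 2 +
      (‖c.branch I true true v‖ ^ 2 + ‖c.branch I true false v‖ ^ 2) = ‖v‖ ^ 2 := by
  simp only [Circuit.branch, Instance.measure, if_true, Bool.false_eq_true, if_false,
    I.norm_sq_axisProj_add, Circuit.sum_norm_sq_flagBranch]

/-- The angle between the state and its projection. -/
noncomputable def Instance.angle : ℝ := Real.arccos I.amplitude

lemma Instance.norm_sq_proj_ψ_add :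
    I.amplitude ^ 2 + ‖I.ψ - I.proj I.ψ‖ ^ 2 = 1 := by
  have := I.norm_sq_axisProj_add Axis.pi I.ψ
  rw [I.norm_ψ] at this
  simpa [Instance.axisProj, Instance.amplitude] using this

lemma Instance.amplitude_nonneg : 0 ≤ I.amplitude := norm_nonneg _

lemma Instance.amplitude_le_one : I.amplitude ≤ 1 := by
  nlinarith [I.norm_sq_proj_ψ_add, I.amplitude_nonneg, sq_nonneg ‖I.ψ - I.proj I.ψ‖]

lemma Instance.cos_angle : Real.cos I.angle = I.amplitude :=
  Real.cos_arccos (by linarith [I.amplitude_nonneg]) I.amplitude_le_one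

lemma Instance.angle_nonneg : 0 ≤ I.angle := Real.arccos_nonneg _

lemma Instance.angle_le : I.angle ≤ Real.pi / 2 := Real.arccos_le_pi_div_two.2 I.amplitude_nonneg

lemma Instance.sin_angle_nonneg : 0 ≤ Real.sin I.angle :=
  Real.sin_nonneg_of_nonneg_of_le_pi I.angle_nonneg (Real.arccos_le_pi _)

lemma Instance.norm_proj_ψ : ‖I.proj I.ψ‖ = Real.cos I.angle := I.cos_angle.symm

lemma Instance.norm_ψ_sub_proj : ‖I.ψ - I.proj I.ψ‖ = Real.sin I.angle := by
  have h := I.norm_sq_proj_ψ_add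
  rw [← I.cos_angle] at h
  refine (sq_eq_sq₀ (norm_nonneg _) I.sin_angle_nonneg).1 ?_
  linarith [Real.cos_sq_add_sin_sq I.angle]

lemma Instance.inner_ψ_proj : inner ℂ I.ψ (I.proj I.ψ) = (Real.cos I.angle : ℂ) ^ 2 := by
  have h := I.isProj.isSymmetric I.ψ (I.proj I.ψ)
  rw [I.proj_proj] at h
  rw [← h, inner_self_eq_norm_sq_to_K, I.norm_proj_ψ]; simp

/-- The unit vector at the angle `φ` from `Πψ` in the plane that is spanned by `ψ` and `Πψ`. -/
noncomputable def Instance.dir (φ : ℝ) : H :=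
  ((Real.cos φ * (Real.cos I.angle)⁻¹ : ℝ) : ℂ) • I.proj I.ψ +
    ((Real.sin φ * (Real.sin I.angle)⁻¹ : ℝ) : ℂ) • (I.ψ - I.proj I.ψ)

/-- Since the inverse of 0 is 0, this includes r = 0. It lets the formulas for `dir` hold for a ∈
{0, 1} without a case distinction. -/
lemma smul_eq_self_of_norm {v : H} {r : ℝ} (h : ‖v‖ = r) : ((r * r⁻¹ : ℝ) : ℂ) • v = v := by
  by_cases hr : r = 0
  · rw [hr, norm_eq_zero] at h; rw [h, smul_zero]
  · rw [mul_inv_cancel₀ hr]; simp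

lemma Instance.dir_angle : I.dir I.angle = I.ψ := by
  rw [Instance.dir, smul_eq_self_of_norm I.norm_proj_ψ, smul_eq_self_of_norm I.norm_ψ_sub_proj]
  simp

lemma Instance.cos_smul_dir_zero : (Real.cos I.angle : ℂ) • I.dir 0 = I.proj I.ψ := by
  rw [Instance.dir, smul_add, smul_smul, ← Complex.ofReal_mul]
  simp only [Real.cos_zero, one_mul, Real.sin_zero, zero_mul, Complex.ofReal_zero, zero_smul,
    smul_zero, add_zero]
  exact smul_eq_self_of_norm I.norm_proj_ψ

lemma Instance.sin_smul_dir : (Real.sin I.angle : ℂ) • I.dir (Real.pi / 2) =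
    I.ψ - I.proj I.ψ := by
  rw [Instance.dir, smul_add, smul_smul, smul_smul, ← Complex.ofReal_mul, ← Complex.ofReal_mul]
  simp only [Real.cos_pi_div_two, zero_mul, mul_zero, Real.sin_pi_div_two, one_mul,
    Complex.ofReal_zero, zero_smul, zero_add]
  exact smul_eq_self_of_norm I.norm_ψ_sub_proj

lemma Instance.proj_dir (φ : ℝ) : I.proj (I.dir φ) =
    ((Real.cos φ * (Real.cos I.angle)⁻¹ : ℝ) : ℂ) • I.proj I.ψ := by
  rw [Instance.dir, map_add, map_smul, map_smul, map_sub, I.proj_proj, sub_self, smul_zero,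
    add_zero]

lemma Instance.inner_ψ_dir (φ : ℝ) : inner ℂ I.ψ (I.dir φ) =
    ((Real.cos (I.angle - φ) : ℝ) : ℂ) := by
  have key : ∀ r : ℝ, r⁻¹ * r ^ 2 = r := fun r => by
    by_cases hr : r = 0
    · simp [hr]
    · field_simp
  have h : inner ℂ I.ψ (I.dir φ) =
      ((Real.cos φ * ((Real.cos I.angle)⁻¹ * Real.cos I.angle ^ 2) +
        Real.sin φ * ((Real.sin I.angle)⁻¹ * Real.sin I.angle ^ 2) : ℝ) : ℂ) := by
    rw [Instance.dir, inner_add_right, inner_smul_right, inner_smul_right, inner_sub_right,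
      I.inner_self_ψ, I.inner_ψ_proj, Real.sin_sq]
    push_cast
    ring
  rw [h, key, key, Real.cos_sub]
  congr 1
  ring

/-- Two directions add up to a multiple of their bisector. A vector and its mirror image have twice
the projection as their sum, so both reflection formulas reduce to this. -/
lemma Instance.dir_add_dir (φ ρ : ℝ) :
    I.dir φ + I.dir ρ = ((2 * Real.cos ((φ - ρ) / 2) : ℝ) : ℂ) • I.dir ((φ + ρ) / 2) := by
  have h1 := Real.cos_add_cos φ ρ
  have h2 : Real.sin φ + Real.sin ρ = 2 * Real.sin ((φ + ρ) / 2) * Real.cos ((φ - ρ) / 2) := by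
    have := Real.sin_sub_sin φ (-ρ)
    rw [Real.sin_neg] at this
    rw [show (φ + ρ) = φ - -ρ by ring, show φ - ρ = φ + -ρ by ring]
    linarith
  have e1 : Real.cos φ = 2 * Real.cos ((φ + ρ) / 2) * Real.cos ((φ - ρ) / 2) - Real.cos ρ := by
    linarith
  have e2 : Real.sin φ = 2 * Real.sin ((φ + ρ) / 2) * Real.cos ((φ - ρ) / 2) - Real.sin ρ := by
    linarith
  simp only [Instance.dir]
  rw [e1, e2]
  push_cast
  module

/-- The reflection `Z v = 2 p v - v`. -/
noncomputable def Instance.reflect (x : Axis) (v : H) : H := (2 : ℂ) • I.axisProj x v - v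

lemma Instance.reflect_pi_dir (φ : ℝ) : I.reflect Axis.pi (I.dir φ) = I.dir (-φ) := by
  rw [Instance.reflect, sub_eq_iff_eq_add, I.dir_add_dir]
  rw [Instance.axisProj, I.proj_dir]
  have : (-φ - φ) / 2 = -φ := by ring
  rw [this, Real.cos_neg, neg_add_cancel, zero_div]
  simp only [Instance.dir, Real.cos_zero, Real.sin_zero]
  push_cast
  module

lemma Instance.reflect_psi_dir (φ : ℝ) :
    I.reflect Axis.psi (I.dir φ) = I.dir (2 * I.angle - φ) := by
  rw [Instance.reflect, sub_eq_iff_eq_add, I.dir_add_dir]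
  rw [Instance.axisProj, I.inner_ψ_dir]
  have h1 : (2 * I.angle - φ - φ) / 2 = I.angle - φ := by ring
  have h2 : (2 * I.angle - φ + φ) / 2 = I.angle := by ring
  rw [h1, h2, I.dir_angle, smul_smul]
  push_cast
  rfl

/-- The direction at the angle `ω` from an axis, measured away from the other axis for `Π`
and towards the other axis for `ψ`. -/
noncomputable def Instance.axisDir : Axis → ℝ → H
  | Axis.pi, ω => I.dir ω
  | Axis.psi, ω => I.dir (I.angle - ω)

/-- The other axis. -/
def Axis.swap : Axis → Axis
  | Axis.psi => Axis.pi
  | Axis.pi => Axis.psi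

/-- The two axes enclose the angle θ. With the orientation chosen in `axisDir`, mirroring at one
axis and then measuring from the other always adds θ, so iteration is trivial. -/
lemma Instance.reflect_axisDir (x : Axis) (ω : ℝ) :
    I.reflect x (I.axisDir x ω) = I.axisDir x.swap (ω + I.angle) := by
  cases x
  · simp only [Instance.axisDir, Axis.swap, I.reflect_psi_dir]
    congr 1; ring
  · simp only [Instance.axisDir, Axis.swap, I.reflect_pi_dir]
    congr 1; ring

/-- Alternating half turns about the two axes. -/
noncomputable def alternating : Axis → ℕ → List (Axis × ℝ)
  | _, 0 => []
  | x, m + 1 => (x, Real.pi / 2) :: alternating x.swap m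

lemma length_alternating (x : Axis) (m : ℕ) : (alternating x m).length = m := by
  induction m generalizing x with
  | zero => rfl
  | succ m ih => simp [alternating, ih]

lemma Instance.gate_smul (x : Axis) (φ : ℝ) (z : ℂ) (v : H) :
    I.gate x φ (z • v) = z • I.gate x φ v := by
  simp only [Instance.gate, I.axisProj_smul]
  module

lemma Instance.evolve_smul (s : ℝ) (l : List (Axis × ℝ)) (z : ℂ) (v : H) :
    I.evolve s l (z • v) = z • I.evolve s l v := by
  induction l generalizing v with
  | nil => rfl
  | cons g l ih => rw [Instance.evolve, I.gate_smul, ih, Instance.evolve]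

lemma Instance.gate_pi_div_two (x : Axis) (v : H) :
    I.gate x (1 * (Real.pi / 2)) v = Complex.I • I.reflect x v := by
  have h : Complex.exp (((1 * (Real.pi / 2) : ℝ) : ℂ) * Complex.I) = Complex.I := by
    push_cast; rw [one_mul, Complex.exp_pi_div_two_mul_I]
  rw [Instance.gate, Complex.exp_neg, h, Complex.inv_I, Instance.reflect]
  module

lemma Instance.gate_neg_pi_div_two (x : Axis) (v : H) :
    I.gate x (-1 * (Real.pi / 2)) v = (-Complex.I) • I.reflect x v := by
  have h : Complex.exp (((-1 * (Real.pi / 2) : ℝ) : ℂ) * Complex.I) = -Complex.I := by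
    push_cast
    rw [neg_one_mul, neg_mul, Complex.exp_neg, Complex.exp_pi_div_two_mul_I, Complex.inv_I]
  rw [Instance.gate, Complex.exp_neg, h, inv_neg, Complex.inv_I, Instance.reflect]
  module

lemma Instance.evolve_alternating_one (x : Axis) (m : ℕ) (ω : ℝ) :
    I.evolve 1 (alternating x m) (I.axisDir x ω) =
      Complex.I ^ m • I.axisDir (Axis.swap^[m] x) (ω + m * I.angle) := by
  induction m generalizing x ω with
  | zero => simp [alternating, Instance.evolve]
  | succ m ih =>
    rw [alternating, Instance.evolve, I.gate_pi_div_two, I.evolve_smul, I.reflect_axisDir, ih,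
      smul_smul, pow_succ', Function.iterate_succ_apply]
    congr 2
    push_cast; ring

lemma Instance.evolve_alternating_neg_one (x : Axis) (m : ℕ) (ω : ℝ) :
    I.evolve (-1) (alternating x m) (I.axisDir x ω) =
      (-Complex.I) ^ m • I.axisDir (Axis.swap^[m] x) (ω + m * I.angle) := by
  induction m generalizing x ω with
  | zero => simp [alternating, Instance.evolve]
  | succ m ih =>
    rw [alternating, Instance.evolve, I.gate_neg_pi_div_two, I.evolve_smul, I.reflect_axisDir, ih,
      smul_smul, pow_succ', Function.iterate_succ_apply]
    congr 2
    push_cast; ring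

/-- The axis of the first rotation that is applied to a state. -/
def Label.firstAxis : Label → Axis
  | Label.psi => Axis.pi
  | Label.psiPerp => Axis.pi
  | Label.pi => Axis.psi
  | Label.piPerp => Axis.psi

/-- Whether a state is the one on its axis, as opposed to the one orthogonal to it. -/
def Label.onAxis : Label → Bool
  | Label.psi => true
  | Label.psiPerp => false
  | Label.pi => true
  | Label.piPerp => false

/-- The length of the vector `I.vec s`. -/
noncomputable def Instance.vecNorm : Label → ℝ
  | Label.psi => 1
  | Label.psiPerp => Real.cos I.angle * Real.sin I.angle
  | Label.pi => Real.cos I.angle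
  | Label.piPerp => Real.sin I.angle

/-- Puts the four states into one form, so that a single computation serves all of them; a
perpendicular state merely lags by π/2. -/
lemma Instance.vec_eq (s : Label) : I.vec s = (I.vecNorm s : ℂ) • I.axisDir s.firstAxis
    (I.angle + if s.onAxis then 0 else -(Real.pi / 2)) := by
  cases s
  · simp [Instance.vec, Instance.vecNorm, Instance.axisDir, Label.firstAxis, Label.onAxis,
      I.dir_angle]
  · simp only [Instance.vec, Instance.vecNorm, Instance.axisDir, Label.firstAxis, Label.onAxis,
      Bool.false_eq_true, if_false, Instance.dir, ← sub_eq_add_neg, Real.cos_sub_pi_div_two,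
      Real.sin_sub_pi_div_two]
    rw [← I.cos_angle]
    have h1 := smul_eq_self_of_norm I.norm_proj_ψ
    have h2 := smul_eq_self_of_norm I.norm_ψ_sub_proj
    have e : I.proj I.ψ - (Real.cos I.angle : ℂ) ^ 2 • I.ψ =
        ((Real.sin I.angle ^ 2 : ℝ) : ℂ) • I.proj I.ψ -
          ((Real.cos I.angle ^ 2 : ℝ) : ℂ) • (I.ψ - I.proj I.ψ) := by
      rw [Real.sin_sq]; push_cast; module
    rw [e]
    nth_rewrite 1 [← h1]
    nth_rewrite 1 [← h2]
    push_cast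
    module
  · simp [Instance.vec, Instance.vecNorm, Instance.axisDir, Label.firstAxis, Label.onAxis,
      ← I.cos_smul_dir_zero]
  · simp [Instance.vec, Instance.vecNorm, Instance.axisDir, Label.firstAxis, Label.onAxis,
      ← I.sin_smul_dir]

lemma Instance.norm_vec (s : Label) : ‖I.vec s‖ ^ 2 = I.vecNorm s ^ 2 := by
  cases s
  · simp [Instance.vec, Instance.vecNorm, I.norm_ψ]
  · have h := I.norm_sq_axisProj_add Axis.psi (I.proj I.ψ)
    simp only [Instance.axisProj, I.inner_ψ_proj, norm_smul, I.norm_ψ, I.norm_proj_ψ] at h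
    rw [norm_pow, Complex.norm_real, Real.norm_eq_abs, sq_abs, mul_one] at h
    simp only [Instance.vec, Instance.vecNorm]
    rw [← I.cos_angle, mul_pow, Real.sin_sq]
    linear_combination h
  · simp [Instance.vec, Instance.vecNorm, I.norm_proj_ψ]
  · simp [Instance.vec, Instance.vecNorm, I.norm_ψ_sub_proj]

lemma Instance.norm_sq_axisProj_psi_axisDir (ω : ℝ) :
    ‖I.axisProj Axis.psi (I.axisDir Axis.psi ω)‖ ^ 2 = Real.cos ω ^ 2 := by
  rw [Instance.axisProj, Instance.axisDir, I.inner_ψ_dir, norm_smul, I.norm_ψ, Complex.norm_real,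
    Real.norm_eq_abs, mul_one, sq_abs, sub_sub_cancel]

lemma Instance.norm_sq_axisProj_pi_axisDir (ω c : ℝ)
    (h : Real.cos I.angle = 0 → Real.cos ω * c = 0) :
    ‖I.axisProj Axis.pi (I.axisDir Axis.pi ω)‖ ^ 2 * c ^ 2 = Real.cos ω ^ 2 * c ^ 2 := by
  rw [Instance.axisProj, Instance.axisDir, I.proj_dir, norm_smul, I.norm_proj_ψ, Complex.norm_real,
    Real.norm_eq_abs, mul_pow, sq_abs]
  by_cases h0 : Real.cos I.angle = 0
  · rw [← mul_pow (Real.cos ω), h h0, h0]; simp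
  · field_simp

lemma Axis.swap_swap (x : Axis) : x.swap.swap = x := by cases x <;> rfl

lemma Axis.iterate_swap_of_even (x : Axis) {m : ℕ} (h : Even m) : Axis.swap^[m] x = x := by
  obtain ⟨k, rfl⟩ := h
  induction k with
  | zero => rfl
  | succ k ih =>
    rw [show k + 1 + (k + 1) = (k + k) + 1 + 1 by ring, Function.iterate_succ_apply,
      Function.iterate_succ_apply, Axis.swap_swap, ih]

lemma Axis.iterate_swap_of_odd (x : Axis) {m : ℕ} (h : Odd m) : Axis.swap^[m] x = x.swap := by
  obtain ⟨k, rfl⟩ := h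
  exact x.swap.iterate_swap_of_even (even_two_mul k)

/-- The degenerate case a = 0: then Πψ = 0 and the projection to `Π` vanishes. The expected factor
vanishes too, because either the state is zero or the final angle is an odd multiple of π/2. -/
lemma Instance.cos_mul_vecNorm_eq_zero (s : Label) (m : ℕ)
    (hx : Axis.swap^[m] s.firstAxis = Axis.pi) (h0 : Real.cos I.angle = 0) :
    Real.cos (I.angle + (if s.onAxis then 0 else -(Real.pi / 2)) + m * I.angle) *
      I.vecNorm s = 0 := by
  have hθ : I.angle = Real.pi / 2 := by
    have := I.cos_angle
    rw [h0] at this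
    rw [Instance.angle, ← this, Real.arccos_zero]
  rcases Nat.even_or_odd m with h | h
  · rw [Axis.iterate_swap_of_even _ h] at hx
    cases s
    · obtain ⟨k, rfl⟩ := h
      have : Real.cos (I.angle + 0 + ((k + k : ℕ) : ℝ) * I.angle) = 0 := by
        rw [Real.cos_eq_zero_iff]; exact ⟨k, by rw [hθ]; push_cast; ring⟩
      simpa [Label.onAxis] using Or.inl this
    · simp [Instance.vecNorm, h0]
    · simp [Instance.vecNorm, h0]
    · cases hx
  · rw [Axis.iterate_swap_of_odd _ h] at hx
    cases s
    · cases hx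
    · simp [Instance.vecNorm, h0]
    · simp [Instance.vecNorm, h0]
    · obtain ⟨k, rfl⟩ := h
      have : Real.cos (I.angle + -(Real.pi / 2) + ((2 * k + 1 : ℕ) : ℝ) * I.angle) = 0 := by
        rw [Real.cos_eq_zero_iff]; exact ⟨k, by rw [hθ]; push_cast; ring⟩
      simpa [Label.onAxis] using Or.inl this

lemma Instance.norm_sq_axisProj_axisDir (s : Label) (m : ℕ) :
    ‖I.axisProj (Axis.swap^[m] s.firstAxis) (I.axisDir (Axis.swap^[m] s.firstAxis)
      (I.angle + (if s.onAxis then 0 else -(Real.pi / 2)) + m * I.angle))‖ ^ 2 *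
        I.vecNorm s ^ 2 =
      Real.cos (I.angle + (if s.onAxis then 0 else -(Real.pi / 2)) + m * I.angle) ^ 2 *
        I.vecNorm s ^ 2 := by
  have h := I.cos_mul_vecNorm_eq_zero s m
  generalize Axis.swap^[m] s.firstAxis = x at *
  cases x
  · rw [I.norm_sq_axisProj_psi_axisDir]
  · exact I.norm_sq_axisProj_pi_axisDir _ _ (h rfl)

/-- The plane that contains all states of a circuit. -/
def Instance.plane : Submodule ℂ H := Submodule.span ℂ {I.ψ, I.proj I.ψ}

lemma Instance.ψ_mem_plane : I.ψ ∈ I.plane := Submodule.subset_span (by simp)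

lemma Instance.proj_ψ_mem_plane : I.proj I.ψ ∈ I.plane := Submodule.subset_span (by simp)

lemma Instance.axisDir_mem_plane (x : Axis) (ω : ℝ) : I.axisDir x ω ∈ I.plane := by
  have h : ∀ φ, I.dir φ ∈ I.plane := fun φ =>
    add_mem (Submodule.smul_mem _ _ I.proj_ψ_mem_plane)
      (Submodule.smul_mem _ _ (sub_mem I.ψ_mem_plane I.proj_ψ_mem_plane))
  cases x
  · exact h _
  · exact h _

lemma Circuit.measure_mem_span (c : Circuit) (o : Bool) {v : H} (hv : v ∈ I.plane) :
    I.measure c.basis o v ∈ Submodule.span ℂ {I.vec (c.outLabel o)} := by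
  obtain ⟨α, β, rfl⟩ := Submodule.mem_span_pair.1 hv
  rw [Submodule.mem_span_singleton]
  unfold Instance.measure Circuit.outLabel
  cases c.basis <;> cases o
  · refine ⟨β, ?_⟩
    simp only [Instance.vec, Bool.false_eq_true, if_false, Instance.axisProj, inner_add_right,
      inner_smul_right, I.inner_self_ψ, I.inner_ψ_proj, I.cos_angle]
    module
  · exact ⟨_, rfl⟩
  · refine ⟨α, ?_⟩
    simp only [Instance.vec, Bool.false_eq_true, if_false, Instance.axisProj, map_add, map_smul,
      I.proj_proj]
    module
  · refine ⟨α + β, ?_⟩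
    simp only [Instance.vec, if_true, Instance.axisProj, map_add, map_smul, I.proj_proj]
    module

/-- Amplitude amplification: the circuit that samples from the Chebyshev polynomial of degree
`m + 1` on the state `s`. Its flag always shows `|0⟩`. -/
noncomputable def amplification (m : ℕ) (s : Label) : Circuit where
  flagged := true
  gates := alternating s.firstAxis m
  flagPhase := -(m * (Real.pi / 2))
  basis := Axis.swap^[m] s.firstAxis
  target := s.onAxis

lemma exp_flagPhase_mul_I_pow (m : ℕ) :
    Complex.exp (((-(m * (Real.pi / 2)) : ℝ) : ℂ) * Complex.I) * Complex.I ^ m = 1 := by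
  have : (((-(m * (Real.pi / 2)) : ℝ) : ℂ) * Complex.I) =
      -((m : ℂ) * ((Real.pi : ℂ) / 2 * Complex.I)) := by
    push_cast; ring
  rw [this, Complex.exp_neg, Complex.exp_nat_mul, Complex.exp_pi_div_two_mul_I]
  exact inv_mul_cancel₀ (pow_ne_zero _ Complex.I_ne_zero)

lemma exp_neg_flagPhase_mul_neg_I_pow (m : ℕ) :
    Complex.exp (-(((-(m * (Real.pi / 2)) : ℝ) : ℂ) * Complex.I)) * (-Complex.I) ^ m = 1 := by
  have : (-(((-(m * (Real.pi / 2)) : ℝ) : ℂ) * Complex.I)) =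
      (m : ℂ) * ((Real.pi : ℂ) / 2 * Complex.I) := by
    push_cast; ring
  rw [this, Complex.exp_nat_mul, Complex.exp_pi_div_two_mul_I, ← mul_pow]
  simp

/-- A half turn by ±π/2 is ±i times a reflection, so the two controlled branches differ only in the
factors i^m and (−i)^m. The flag phase cancels these, the branches coincide, and the flag never
shows 1. -/
lemma flagBranch_amplification (m : ℕ) (s : Label) (f : Bool) (z : ℂ) :
    (amplification m s).flagBranch I f (z • I.vec s) =
      if f then 0 else (z * I.vecNorm s) • I.axisDir (Axis.swap^[m] s.firstAxis)
        (I.angle + (if s.onAxis then 0 else -(Real.pi / 2)) + m * I.angle) := by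
  simp only [Circuit.flagBranch, amplification, if_true]
  rw [I.vec_eq, smul_smul, I.evolve_smul, I.evolve_smul, I.evolve_alternating_one,
    I.evolve_alternating_neg_one]
  set w := I.axisDir (Axis.swap^[m] s.firstAxis)
    (I.angle + (if s.onAxis then 0 else -(Real.pi / 2)) + m * I.angle)
  have key : ∀ e i y : ℂ, e * i = 1 → e • y • i • w = y • w := fun e i y h => by
    rw [smul_smul, smul_smul, mul_right_comm, h, one_mul]
  rw [key _ _ _ (exp_flagPhase_mul_I_pow m), key _ _ _ (exp_neg_flagPhase_mul_neg_I_pow m)]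
  cases f
  · simp only [Bool.false_eq_true, if_false]; module
  · simp only [if_true]; module

end Geometry

lemma samplesFrom_amplification (m : ℕ) (s : Label) :
    Circuit.SamplesFrom.{u} (amplification m s) (Chebyshev.T ℂ ((m + 1 : ℕ) : ℤ)) s := by
  intro H _ _ I v hv
  obtain ⟨z, rfl⟩ := Submodule.mem_span_singleton.1 hv
  refine ⟨?_, fun f o => ?_⟩
  · rw [← I.cos_angle, norm_sq_eval_chebyshev, Circuit.branch, flagBranch_amplification]
    simp only [Bool.false_eq_true, if_false]
    have hnorm : ‖z • I.vec s‖ ^ 2 = ‖z‖ ^ 2 * I.vecNorm s ^ 2 := by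
      rw [norm_smul, mul_pow, I.norm_vec]
    -- For a ∈ {0, 1} the vector `dir` need not have norm 1, so the norm of the final state is taken
    -- from conservation of probability.
    have hev := (amplification m s).sum_norm_sq_flagBranch I (z • I.vec s)
    rw [flagBranch_amplification, flagBranch_amplification, if_neg Bool.false_ne_true,
      if_pos rfl, norm_zero] at hev
    have key := I.norm_sq_axisProj_axisDir s m
    set ω := I.angle + (if s.onAxis then 0 else -(Real.pi / 2)) + m * I.angle with hω
    have hp : ‖I.axisProj (Axis.swap^[m] s.firstAxis) ((z * I.vecNorm s) •
        I.axisDir (Axis.swap^[m] s.firstAxis) ω)‖ ^ 2 =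
        Real.cos ω ^ 2 * ‖z • I.vec s‖ ^ 2 := by
      rw [I.axisProj_smul, norm_smul, hnorm, mul_pow, norm_mul, mul_pow, Complex.norm_real,
        Real.norm_eq_abs, sq_abs]
      linear_combination ‖z‖ ^ 2 * key
    have hsum := I.norm_sq_axisProj_add (Axis.swap^[m] s.firstAxis) ((z * I.vecNorm s) •
        I.axisDir (Axis.swap^[m] s.firstAxis) ω)
    change ‖I.measure (Axis.swap^[m] s.firstAxis) s.onAxis _‖ ^ 2 = _
    unfold Instance.measure
    cases hs : s.onAxis
    -- With the lag of π/2, the outcome off the axis has probability 1 − sin²((m+1)θ), which is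
    -- again cos²((m+1)θ).
    · rw [hs, if_neg Bool.false_ne_true] at hω
      have : ω = ((m + 1 : ℕ) : ℝ) * I.angle - Real.pi / 2 := by rw [hω]; push_cast; ring
      rw [this, Real.cos_sub_pi_div_two] at hp
      simp only [Bool.false_eq_true, if_false]
      rw [← this] at hp
      rw [Real.cos_sq']
      linarith
    · rw [hs, if_pos rfl] at hω
      have : ω = ((m + 1 : ℕ) : ℝ) * I.angle := by rw [hω]; push_cast; ring
      simp only [if_true]
      rw [hp, this]
  · rw [Circuit.branch]
    refine Circuit.measure_mem_span I _ _ ?_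
    rw [flagBranch_amplification]
    cases f
    · simpa using Submodule.smul_mem _ _ (I.axisDir_mem_plane _ _)
    · simp

/-! ### Expectations of functions of the estimate -/

section Expect

variable {H : Type u} [NormedAddCommGroup H] [InnerProductSpace ℂ H] (I : Instance H)

/-- The expectation of `g` at the estimate, weighted with the squared norm of the register. -/
noncomputable def Procedure.expect (g : ℝ → ℝ) : Procedure → H → ℝ
  | Procedure.done r, v => ‖v‖ ^ 2 * g r
  | Procedure.sample _ c next, v =>
      ∑ f : Bool, ∑ o : Bool, (next f o).expect g (c.branch I f o v)

lemma Procedure.expect_nonneg {g : ℝ → ℝ} (hg : ∀ r, 0 ≤ g r) (A : Procedure) (v : H) :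
    0 ≤ A.expect I g v := by
  induction A generalizing v with
  | done r => exact mul_nonneg (sq_nonneg _) (hg r)
  | sample P c next ih =>
    exact Finset.sum_nonneg fun f _ => Finset.sum_nonneg fun o _ => ih f o _

/-- Replaces the measure by a finite recursion over the outcomes, in which all later estimates are
made. -/
lemma Procedure.lintegral_lawFrom {g : ℝ → ℝ} (hg : ∀ r, 0 ≤ g r) (A : Procedure) (v : H)
    (D Q : ℕ) :
    ∫⁻ r, ENNReal.ofReal (g r.estimate) ∂(A.lawFrom I v D Q) =
      ENNReal.ofReal (A.expect I g v) := by
  induction A generalizing v D Q with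
  | done r =>
    rw [Procedure.lawFrom, lintegral_smul_measure, lintegral_dirac, Procedure.expect,
      ENNReal.ofReal_mul (sq_nonneg _), smul_eq_mul]
  | sample P c next ih =>
    have h := fun f o => Procedure.expect_nonneg I hg (next f o) (c.branch I f o v)
    rw [Procedure.lawFrom, lintegral_finsetSum_measure, Procedure.expect,
      ENNReal.ofReal_sum_of_nonneg fun f _ => Finset.sum_nonneg fun o _ => h f o]
    refine Finset.sum_congr rfl fun f _ => ?_
    rw [lintegral_finsetSum_measure, ENNReal.ofReal_sum_of_nonneg fun o _ => h f o]
    exact Finset.sum_congr rfl fun o _ => ih f o _ _ _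

/-- The polynomials that are sampled from have positive degrees, the sum of which is `d`
whatever is observed, and every estimate lies in `S`. -/
def Procedure.Conforms (S : Set ℝ) : Procedure → ℕ → Prop
  | Procedure.done r, d => r ∈ S ∧ d = 0
  | Procedure.sample P _ next, d => 1 ≤ P.natDegree ∧ P.natDegree ≤ d ∧
      ∀ f o : Bool, (next f o).Conforms S (d - P.natDegree)

lemma Procedure.Conforms.mono {S T : Set ℝ} (h : S ⊆ T) {A : Procedure} {d : ℕ}
    (hA : A.Conforms S d) : A.Conforms T d := by
  induction A generalizing d with
  | done r => exact ⟨h hA.1, hA.2⟩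
  | sample P c next ih => exact ⟨hA.1, hA.2.1, fun f o => ih f o (hA.2.2 f o)⟩

lemma Procedure.Conforms.expect_le {S : Set ℝ} {g : ℝ → ℝ} {B : ℝ} (hg : ∀ r ∈ S, g r ≤ B)
    {A : Procedure} {d : ℕ} (hA : A.Conforms S d) (v : H) :
    A.expect I g v ≤ B * ‖v‖ ^ 2 := by
  induction A generalizing d v with
  | done r =>
    rw [Procedure.expect, mul_comm]
    exact mul_le_mul_of_nonneg_right (hg r hA.1) (sq_nonneg _)
  | sample P c next ih =>
    have h := fun f o => ih f o (hA.2.2 f o) (c.branch I f o v)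
    simp only [Procedure.expect, Fintype.sum_bool]
    have := c.sum_norm_sq_branch I v
    rw [← this]
    linarith [h true true, h true false, h false true, h false false]

lemma Procedure.expect_one (A : Procedure) (v : H) : A.expect I (fun _ => 1) v = ‖v‖ ^ 2 := by
  induction A generalizing v with
  | done r => rw [Procedure.expect, mul_one]
  | sample P c next ih =>
    simp only [Procedure.expect, Fintype.sum_bool, ih]
    linarith [c.sum_norm_sq_branch I v]

/-- A step with degree at least 1 uses at most deg + 3 ≤ 4 deg queries; hence the factor 4. -/
lemma Procedure.Conforms.ae_lawFrom {S : Set ℝ} {A : Procedure} {s : Label}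
    (hs : Procedure.SamplesPolynomialsFrom.{u} A s) {d : ℕ}
    (hA : A.Conforms S d) (v : H) (D Q : ℕ) :
    ∀ᵐ r ∂(A.lawFrom I v D Q), r.estimate ∈ S ∧ r.degree = D + d ∧ r.queries ≤ Q + 4 * d := by
  induction A generalizing s d v D Q with
  | done r =>
    rw [Procedure.lawFrom]
    refine Measure.ae_smul_measure ?_ _
    rw [ae_dirac_eq]
    exact ⟨hA.1, by simp [hA.2], by simp⟩
  | sample P c next ih =>
    obtain ⟨h1, h2, h3⟩ := hA
    obtain ⟨-, h5, -, h6⟩ := hs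
    have key : ∀ f o : Bool, ∀ᵐ r ∂((next f o).lawFrom I (c.branch I f o v) (D + P.natDegree)
        (Q + c.queries)), r.estimate ∈ S ∧ r.degree = D + d ∧ r.queries ≤ Q + 4 * d := by
      intro f o
      filter_upwards [ih f o (h6 f o) (h3 f o) (c.branch I f o v) (D + P.natDegree)
        (Q + c.queries)] with r hr
      exact ⟨hr.1, by omega, by omega⟩
    rw [Procedure.lawFrom]
    simp only [Fintype.sum_bool, ae_add_measure_iff]
    exact ⟨⟨key _ _, key _ _⟩, key _ _, key _ _⟩

/-! ### From the recursive expectation to the law of the outcome -/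

lemma Procedure.isProbabilityMeasure_law (A : Procedure) : IsProbabilityMeasure (A.law I) := by
  constructor
  have h := Procedure.lintegral_lawFrom I (g := fun _ => 1) (fun _ => zero_le_one) A I.ψ 0 0
  rw [A.expect_one, I.norm_ψ] at h
  simpa [Procedure.law] using h

lemma Procedure.law_le_of_expect_le (A : Procedure) {S : Set ℝ} {B : ℝ}
    (h : A.expect I (S.indicator fun _ => 1) I.ψ ≤ B) :
    A.law I {r | r.estimate ∈ S} ≤ ENNReal.ofReal B := by
  have h1 := Procedure.lintegral_lawFrom I (g := S.indicator fun _ => 1)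
    (Set.indicator_nonneg fun _ _ => zero_le_one) A I.ψ 0 0
  have h2 : (fun r : Outcome => ENNReal.ofReal (S.indicator (fun _ => (1 : ℝ)) r.estimate)) =
      {r : Outcome | r.estimate ∈ S}.indicator (fun _ => 1) := by
    ext r
    by_cases hr : r.estimate ∈ S <;> simp [hr]
  rw [h2, lintegral_indicator_const MeasurableSpace.measurableSet_top, one_mul] at h1
  rw [Procedure.law, h1]
  exact ENNReal.ofReal_le_ofReal h

/-- The bias is at most the mean absolute error, and only the latter is ever estimated. -/
lemma Procedure.abs_integral_sub_le (A : Procedure) {a B : ℝ} (hB : 0 ≤ B)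
    (hint : Integrable (fun r : Outcome => r.estimate) (A.law I))
    (h : A.expect I (fun r => |r - a|) I.ψ ≤ B) :
    |(∫ r, r.estimate ∂(A.law I)) - a| ≤ B := by
  have := A.isProbabilityMeasure_law I
  have h1 : (∫ r, r.estimate ∂(A.law I)) - a = ∫ r : Outcome, (r.estimate - a) ∂(A.law I) := by
    rw [integral_sub hint (integrable_const a), integral_const]
    simp
  rw [h1]
  refine abs_integral_le_integral_abs.trans ?_
  have h2 : AEStronglyMeasurable (fun r : Outcome => |r.estimate - a|) (A.law I) :=
    (hint.sub (integrable_const a)).aestronglyMeasurable.norm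
  rw [integral_eq_lintegral_of_nonneg_ae (Filter.Eventually.of_forall fun _ => abs_nonneg _) h2,
    Procedure.law,
    Procedure.lintegral_lawFrom I (g := fun r => |r - a|) fun _ => abs_nonneg _]
  exact ENNReal.toReal_le_of_le_ofReal hB (ENNReal.ofReal_le_ofReal h)

end Expect

/-! ### Repeated samples -/

/-- The expectation of `F` at a binomially distributed number. -/
noncomputable def binExp (p : ℝ) : ℕ → (ℕ → ℝ) → ℝ
  | 0, F => F 0
  | m + 1, F => p * binExp p m (fun h => F (h + 1)) + (1 - p) * binExp p m F

section BinExp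

variable {p : ℝ}

lemma binExp_mono (hp0 : 0 ≤ p) (hp1 : p ≤ 1) (m : ℕ) {F G : ℕ → ℝ} (h : ∀ k, F k ≤ G k) :
    binExp p m F ≤ binExp p m G := by
  induction m generalizing F G with
  | zero => exact h 0
  | succ m ih =>
    exact add_le_add (mul_le_mul_of_nonneg_left (ih fun k => h _) hp0)
      (mul_le_mul_of_nonneg_left (ih h) (sub_nonneg.2 hp1))

lemma binExp_const (m : ℕ) (c : ℝ) : binExp p m (fun _ => c) = c := by
  induction m with
  | zero => rfl
  | succ m ih => rw [binExp, ih]; ring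

lemma binExp_add (m : ℕ) (F G : ℕ → ℝ) :
    binExp p m (fun k => F k + G k) = binExp p m F + binExp p m G := by
  induction m generalizing F G with
  | zero => rfl
  | succ m ih => rw [binExp, ih, ih, binExp, binExp]; ring

lemma binExp_const_mul (m : ℕ) (c : ℝ) (F : ℕ → ℝ) :
    binExp p m (fun k => c * F k) = c * binExp p m F := by
  induction m generalizing F with
  | zero => rfl
  | succ m ih => rw [binExp, ih, ih, binExp]; ring

lemma binExp_exp (m : ℕ) (t : ℝ) :
    binExp p m (fun k => Real.exp (t * k)) = (p * Real.exp t + (1 - p)) ^ m := by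
  induction m with
  | zero => simp [binExp]
  | succ m ih =>
    have : (fun k : ℕ => Real.exp (t * ((k + 1 : ℕ) : ℝ))) =
        fun k : ℕ => Real.exp t * Real.exp (t * k) := by
      ext k; rw [← Real.exp_add]; push_cast; ring_nf
    rw [binExp, this, binExp_const_mul, ih]; ring

/-- After centring, e^x ≤ 1 + x + x² for |x| ≤ 1 kills the linear term and leaves 1 + t²p(1−p) ≤
exp(t²). -/
lemma bernoulli_exp_le (hp0 : 0 ≤ p) (hp1 : p ≤ 1) {t : ℝ} (ht : |t| ≤ 1) :
    p * Real.exp t + (1 - p) ≤ Real.exp (t ^ 2 + t * p) := by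
  have b : ∀ y : ℝ, |y| ≤ 1 → Real.exp (t * y) ≤ 1 + t * y + t ^ 2 * y ^ 2 := fun y hy => by
    have h : |t * y| ≤ 1 := by
      rw [abs_mul]; exact mul_le_one₀ ht (abs_nonneg _) hy
    have := (abs_le.1 (Real.abs_exp_sub_one_sub_id_le h)).2
    nlinarith
  have b1 := b (1 - p) (abs_le.2 ⟨by linarith, by linarith⟩)
  have b2 := b (-p) (abs_le.2 ⟨by linarith, by linarith⟩)
  have e : p * Real.exp t + (1 - p) =
      (p * Real.exp (t * (1 - p)) + (1 - p) * Real.exp (t * -p)) * Real.exp (t * p) := by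
    rw [add_mul, mul_assoc, mul_assoc, ← Real.exp_add, ← Real.exp_add]
    ring_nf
    rw [Real.exp_zero]
    ring
  rw [e, Real.exp_add]
  refine mul_le_mul_of_nonneg_right ?_ (Real.exp_nonneg _)
  have h1 := mul_le_mul_of_nonneg_left b1 hp0
  have h2 := mul_le_mul_of_nonneg_left b2 (sub_nonneg.2 hp1)
  have h3 := Real.add_one_le_exp (t ^ 2)
  have h4 : p * (1 - p) ≤ 1 := by nlinarith
  have h5 : t ^ 2 * (p * (1 - p)) ≤ t ^ 2 := mul_le_of_le_one_right (sq_nonneg t) h4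
  nlinarith

lemma binExp_exp_le (hp0 : 0 ≤ p) (hp1 : p ≤ 1) (m : ℕ) {t : ℝ} (ht : |t| ≤ 1) (c : ℝ) :
    binExp p m (fun k => Real.exp (t * (k - m * p) - m * c)) ≤ Real.exp (m * (t ^ 2 - c)) := by
  have e : (fun k : ℕ => Real.exp (t * (k - m * p) - m * c)) =
      fun k : ℕ => Real.exp (-(m * (t * p + c))) * Real.exp (t * k) := by
    ext k; rw [← Real.exp_add]; ring_nf
  rw [e, binExp_const_mul, binExp_exp]
  calc _ ≤ Real.exp (-(m * (t * p + c))) * Real.exp (t ^ 2 + t * p) ^ m := by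
        refine mul_le_mul_of_nonneg_left (pow_le_pow_left₀ ?_ (bernoulli_exp_le hp0 hp1 ht) m)
          (Real.exp_nonneg _)
        have := mul_nonneg hp0 (Real.exp_nonneg t)
        linarith
    _ = _ := by
        rw [← Real.exp_nat_mul, ← Real.exp_add]; ring_nf

/-- A Chernoff bound: if `F ≤ V` when the relative frequency is within `1/8` of `p`, and
`F ≤ V + W` otherwise. -/
lemma binExp_le_of_deviation (hp0 : 0 ≤ p) (hp1 : p ≤ 1) (m : ℕ) {F : ℕ → ℝ} {V W : ℝ} (hW : 0 ≤ W)
    (h1 : ∀ k : ℕ, |(k : ℝ) - m * p| < m / 8 → F k ≤ V) (h2 : ∀ k, F k ≤ V + W) :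
    binExp p m F ≤ V + W * (2 * Real.exp (-(m / 256))) := by
  -- The exponents are nonnegative once the deviation reaches m/8, since (1/16)(m/8) = m/128. With t
  -- = ±1/16 each expectation is at most exp(m(1/256 − 1/128)) = exp(−m/256).
  have hF : ∀ k : ℕ, F k ≤ V + W * (Real.exp (1 / 16 * (k - m * p) - m * (1 / 128)) +
      Real.exp (-(1 / 16) * (k - m * p) - m * (1 / 128))) := by
    intro k
    by_cases hk : |(k : ℝ) - m * p| < m / 8
    · refine (h1 k hk).trans (le_add_of_nonneg_right (mul_nonneg hW ?_))
      positivity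
    · refine (h2 k).trans (add_le_add_right (le_mul_of_one_le_right hW ?_) V)
      rw [not_lt] at hk
      rcases le_abs.1 hk with h | h
      · exact (Real.one_le_exp (by linarith)).trans (le_add_of_nonneg_right (Real.exp_nonneg _))
      · exact (Real.one_le_exp (by linarith)).trans (le_add_of_nonneg_left (Real.exp_nonneg _))
  refine (binExp_mono hp0 hp1 m hF).trans ?_
  rw [binExp_add, binExp_const, binExp_const_mul, binExp_add]
  have e1 := binExp_exp_le hp0 hp1 m (t := 1 / 16) (by norm_num) (1 / 128)
  have e2 := binExp_exp_le hp0 hp1 m (t := -(1 / 16)) (by norm_num) (1 / 128)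
  have e3 : (m : ℝ) * ((1 / 16) ^ 2 - 1 / 128) = -(m / 256) := by ring
  have e4 : (m : ℝ) * ((-(1 / 16)) ^ 2 - 1 / 128) = -(m / 256) := by ring
  rw [e3] at e1
  rw [e4] at e2
  exact add_le_add_right (mul_le_mul_of_nonneg_left (by linarith) hW) V

end BinExp

/-- Sample `m` times from the Chebyshev polynomial of degree `n + 1`, and continue with the
number of ones. -/
noncomputable def batch (n : ℕ) : ℕ → Label → (ℕ → Label → Procedure) → Procedure
  | 0, s, cont => cont 0 s
  | m + 1, s, cont =>
      Procedure.sample (Chebyshev.T ℂ ((n + 1 : ℕ) : ℤ)) (amplification n s) fun f o =>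
        batch n m ((amplification n s).outLabel o) fun h s' =>
          cont (if f = false ∧ o = s.onAxis then h + 1 else h) s'

lemma natDegree_chebyshev (n : ℕ) : (Chebyshev.T ℂ ((n + 1 : ℕ) : ℤ)).natDegree = n + 1 := by
  rw [Chebyshev.natDegree_T]; rfl

lemma samplesPolynomialsFrom_sample_chebyshev (n : ℕ) (s : Label)
    {next : Bool → Bool → Procedure}
    (h : ∀ f o, Procedure.SamplesPolynomialsFrom.{u} (next f o)
      ((amplification n s).outLabel o)) :
    Procedure.SamplesPolynomialsFrom.{u} (Procedure.sample (Chebyshev.T ℂ ((n + 1 : ℕ) : ℤ))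
      (amplification n s) next) s := by
  refine ⟨?_, ?_, samplesFrom_amplification n s, h⟩
  · rw [if_pos (show (amplification n s).flagged = true from rfl)]
    exact ⟨_, isSemiPellian_chebyshev n, (Chebyshev.map_T _ _).symm⟩
  · rw [natDegree_chebyshev, Circuit.queries, amplification, length_alternating]
    omega

lemma samplesPolynomialsFrom_batch (n m : ℕ) (s : Label) {cont : ℕ → Label → Procedure}
    (h : ∀ k s, Procedure.SamplesPolynomialsFrom.{u} (cont k s) s) :
    Procedure.SamplesPolynomialsFrom.{u} (batch n m s cont) s := by
  induction m generalizing s cont with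
  | zero => exact h 0 s
  | succ m ih =>
    exact samplesPolynomialsFrom_sample_chebyshev n s fun f o => ih _ fun k s => h _ s

lemma onlySemiPellian_batch (n m : ℕ) (s : Label) {cont : ℕ → Label → Procedure}
    (h : ∀ k s, (cont k s).OnlySemiPellian) : (batch n m s cont).OnlySemiPellian := by
  induction m generalizing s cont with
  | zero => exact h 0 s
  | succ m ih => exact ⟨rfl, fun f o => ih _ fun k s => h _ s⟩

lemma conforms_batch {S : Set ℝ} (n m : ℕ) (s : Label) {cont : ℕ → Label → Procedure} {d : ℕ}
    (h : ∀ k s, (cont k s).Conforms S d) : (batch n m s cont).Conforms S ((n + 1) * m + d) := by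
  induction m generalizing s cont with
  | zero => simpa [batch] using h 0 s
  | succ m ih =>
    refine ⟨?_, ?_, fun f o => ?_⟩
    · rw [natDegree_chebyshev]; omega
    · rw [natDegree_chebyshev, mul_add]; omega
    · rw [natDegree_chebyshev,
        show (n + 1) * (m + 1) + d - (n + 1) = (n + 1) * m + d by rw [mul_add]; omega]
      exact ih _ fun k s => h _ s

/-- Each sample leaves one of the four states and has the same success probability on all of them,
so the samples behave like independent coin tosses and the number of ones is binomial. -/
lemma expect_batch_le {H : Type u} [NormedAddCommGroup H] [InnerProductSpace ℂ H]
    (I : Instance H) (g : ℝ → ℝ) (n m : ℕ) (s : Label) {cont : ℕ → Label → Procedure}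
    {F : ℕ → ℝ}
    (h : ∀ k s, ∀ v ∈ Submodule.span ℂ {I.vec s}, (cont k s).expect I g v ≤ F k * ‖v‖ ^ 2)
    {v : H} (hv : v ∈ Submodule.span ℂ {I.vec s}) :
    (batch n m s cont).expect I g v ≤
      binExp (Real.cos ((n + 1) * I.angle) ^ 2) m F * ‖v‖ ^ 2 := by
  induction m generalizing s cont F v with
  | zero => exact h 0 s v hv
  | succ m ih =>
    obtain ⟨hp, hb⟩ := samplesFrom_amplification n s H I v hv
    rw [← I.cos_angle, norm_sq_eval_chebyshev] at hp
    have hsum := (amplification n s).sum_norm_sq_branch I v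
    set b := fun f o => (amplification n s).branch I f o v with hbdef
    have key : ∀ f o, (batch n m ((amplification n s).outLabel o) fun h s' =>
        cont (if f = false ∧ o = s.onAxis then h + 1 else h) s').expect I g (b f o) ≤
        binExp (Real.cos ((n + 1) * I.angle) ^ 2) m
          (fun k => F (if f = false ∧ o = s.onAxis then k + 1 else k)) * ‖b f o‖ ^ 2 :=
      fun f o => ih (F := fun k => F (if f = false ∧ o = s.onAxis then k + 1 else k)) _
        (fun k s v hv => h _ s v hv) (hb f o)
    simp only [batch, Procedure.expect, Fintype.sum_bool, binExp]
    have k1 := key true true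
    have k2 := key true false
    have k3 := key false true
    have k4 := key false false
    change ‖b false s.onAxis‖ ^ 2 = _ at hp
    change ‖b false true‖ ^ 2 + ‖b false false‖ ^ 2 + (‖b true true‖ ^ 2 + ‖b true false‖ ^ 2) =
      _ at hsum
    push_cast at hp
    set X := binExp (Real.cos ((n + 1) * I.angle) ^ 2) m (fun k => F (k + 1))
    set Y := binExp (Real.cos ((n + 1) * I.angle) ^ 2) m F
    cases hs : s.onAxis
    · rw [hs] at hp
      simp only [hs, Bool.true_eq_false, and_false, and_true, if_true, if_false] at k1 k2 k3 k4 ⊢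
      have e : (Real.cos ((n + 1) * I.angle) ^ 2 * X +
          (1 - Real.cos ((n + 1) * I.angle) ^ 2) * Y) * ‖v‖ ^ 2 =
          X * ‖b false false‖ ^ 2 + Y * (‖v‖ ^ 2 - ‖b false false‖ ^ 2) := by
        rw [hp]; ring
      rw [e, ← hsum]
      linarith
    · rw [hs] at hp
      simp only [hs, Bool.true_eq_false, Bool.false_eq_true, and_false, and_true, if_true,
        if_false] at k1 k2 k3 k4 ⊢
      have e : (Real.cos ((n + 1) * I.angle) ^ 2 * X +
          (1 - Real.cos ((n + 1) * I.angle) ^ 2) * Y) * ‖v‖ ^ 2 =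
          X * ‖b false true‖ ^ 2 + Y * (‖v‖ ^ 2 - ‖b false true‖ ^ 2) := by
        rw [hp]; ring
      rw [e, ← hsum]
      linarith

/-! ### Nested intervals for the angle -/

/-- The `k`-th interval on which `cos² (n θ)` is monotone. -/
def cell (n k : ℕ) : Set ℝ :=
  {θ | k * (Real.pi / 2) ≤ n * θ ∧ n * θ ≤ (k + 1) * (Real.pi / 2)}

/-- The half or the middle third of the `k`-th interval that is chosen after `h` ones in `m`
samples of `cos² (n θ)`. -/
def subcell (n k m h : ℕ) : ℕ × ℕ :=
  if 3 * m ≤ 8 * h ∧ 8 * h ≤ 5 * m then (3 * n, 3 * k + 1)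
  else if 5 * m < 8 * h ↔ Even k then (2 * n, 2 * k) else (2 * n, 2 * k + 1)

lemma subcell_fst (n k m h : ℕ) :
    (subcell n k m h).1 = 2 * n ∨ (subcell n k m h).1 = 3 * n := by
  unfold subcell
  split_ifs <;> simp

/-- Holds whatever h is: even a wrong decision keeps all later estimates in the current cell. -/
lemma cell_subcell_subset (n k m h : ℕ) :
    cell (subcell n k m h).1 (subcell n k m h).2 ⊆ cell n k := by
  intro θ hθ
  have hπ := Real.pi_pos
  unfold subcell at hθ
  split_ifs at hθ <;> obtain ⟨h1, h2⟩ := hθ <;> push_cast at h1 h2 <;>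
    constructor <;> nlinarith

lemma cos_sq_nat_mul (n k : ℕ) (θ : ℝ) :
    Real.cos (n * θ) ^ 2 = 1 / 2 + (-1) ^ k * Real.cos (2 * (n * θ) - k * Real.pi) / 2 := by
  have h : ((-1 : ℝ) ^ k) * (-1) ^ k = 1 := by rw [← mul_pow]; norm_num
  rw [Real.cos_sq, Real.cos_sub_nat_mul_pi, ← mul_assoc ((-1 : ℝ) ^ k), h, one_mul]

/-- With y = 2nθ − kπ in [0, π], cos²(nθ) is 1/2 ± (cos y)/2, the sign being the parity of k. A
frequency in [3/8, 5/8] forces |cos y| < 1/2, the middle third; any other frequency fixes the sign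
of cos y, hence the half. -/
lemma mem_cell_subcell {n k m h : ℕ} {θ : ℝ} (hθ : θ ∈ cell n k)
    (hh : |(h : ℝ) - m * Real.cos (n * θ) ^ 2| < m / 8) :
    θ ∈ cell (subcell n k m h).1 (subcell n k m h).2 := by
  have hπ := Real.pi_pos
  obtain ⟨h1, h2⟩ := hθ
  obtain ⟨a1, a2⟩ := abs_lt.1 hh
  have hm : (0 : ℝ) < m := by linarith
  set y := 2 * (n * θ) - k * Real.pi with hy
  have hy0 : 0 ≤ y := by linarith
  have hyπ : y ≤ Real.pi := by linarith
  have hcos := cos_sq_nat_mul n k θ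
  rw [← hy] at hcos
  rw [hcos] at a1 a2
  have hlt : ∀ z, 0 ≤ z → z < y → Real.cos y < Real.cos z := fun z hz hzy =>
    Real.cos_lt_cos_of_nonneg_of_le_pi hz hyπ hzy
  have hgt : ∀ z, z ≤ Real.pi → y < z → Real.cos z < Real.cos y := fun z hz hzy =>
    Real.cos_lt_cos_of_nonneg_of_le_pi hy0 hz hzy
  have c2 : Real.cos (2 * (Real.pi / 3)) = -1 / 2 := by
    rw [Real.cos_two_mul, Real.cos_pi_div_three]; norm_num
  have first : 0 < Real.cos y → θ ∈ cell (2 * n) (2 * k) := fun hc => by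
    have : y ≤ Real.pi / 2 := by
      by_contra hcon
      have := hlt (Real.pi / 2) (by linarith) (not_le.1 hcon)
      rw [Real.cos_pi_div_two] at this
      linarith
    constructor <;> push_cast <;> linarith
  have second : Real.cos y < 0 → θ ∈ cell (2 * n) (2 * k + 1) := fun hc => by
    have : Real.pi / 2 ≤ y := by
      by_contra hcon
      have := hgt (Real.pi / 2) (by linarith) (not_le.1 hcon)
      rw [Real.cos_pi_div_two] at this
      linarith
    constructor <;> push_cast <;> linarith
  have middle : -1 / 2 < Real.cos y → Real.cos y < 1 / 2 → θ ∈ cell (3 * n) (3 * k + 1) :=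
    fun hc hc' => by
      have i1 : Real.pi / 3 ≤ y := by
        by_contra hcon
        have := hgt (Real.pi / 3) (by linarith) (not_le.1 hcon)
        rw [Real.cos_pi_div_three] at this
        linarith
      have i2 : y ≤ 2 * (Real.pi / 3) := by
        by_contra hcon
        have := hlt (2 * (Real.pi / 3)) (by linarith) (not_le.1 hcon)
        linarith
      constructor <;> push_cast <;> linarith
  have cancel : ∀ z w : ℝ, m * z < m * w → z < w := fun z w hzw => lt_of_mul_lt_mul_left hzw hm.le
  unfold subcell
  rcases Nat.even_or_odd k with hk | hk
  · rw [hk.neg_one_pow, one_mul] at a1 a2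
    split_ifs with b1 b2
    · have d1 : (3 : ℝ) * m ≤ 8 * h := by exact_mod_cast b1.1
      have d2 : (8 : ℝ) * h ≤ 5 * m := by exact_mod_cast b1.2
      exact middle (cancel _ _ (by linarith)) (cancel _ _ (by linarith))
    · have d1 : (5 : ℝ) * m < 8 * h := by exact_mod_cast b2.2 hk
      exact first (cancel _ _ (by linarith))
    · have d1 : (8 : ℝ) * h < 3 * m := by
        have : 8 * h < 3 * m := by
          by_contra hcon
          have : 5 * m < 8 * h := by omega
          exact b2 (iff_of_true this hk)
        exact_mod_cast this
      exact second (cancel _ _ (by linarith))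
  · have hk' := Nat.not_even_iff_odd.2 hk
    rw [hk.neg_one_pow, neg_one_mul] at a1 a2
    split_ifs with b1 b2
    · have d1 : (3 : ℝ) * m ≤ 8 * h := by exact_mod_cast b1.1
      have d2 : (8 : ℝ) * h ≤ 5 * m := by exact_mod_cast b1.2
      exact middle (cancel _ _ (by linarith)) (cancel _ _ (by linarith))
    · have d1 : (8 : ℝ) * h < 3 * m := by
        have : ¬ 5 * m < 8 * h := fun h' => hk' (b2.1 h')
        have : 8 * h < 3 * m := by omega
        exact_mod_cast this
      exact first (cancel _ _ (by linarith))
    · have d1 : (5 : ℝ) * m < 8 * h := by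
        have : 5 * m < 8 * h := by
          by_contra hcon
          exact b2 (iff_of_false hcon hk')
        exact_mod_cast this
      exact second (cancel _ _ (by linarith))

/-- The cell has length π/(2n), and the cosine is 1-Lipschitz. -/
lemma abs_cos_sub_cos_le_of_mem_cell {n k : ℕ} (hn : 1 ≤ n) {θ ρ : ℝ} (hθ : θ ∈ cell n k)
    (hρ : ρ ∈ cell n k) : |Real.cos ρ - Real.cos θ| ≤ Real.pi / (2 * n) := by
  have hn' : (0 : ℝ) < n := by exact_mod_cast hn
  have h := Real.abs_cos_sub_cos_le ρ θ
  refine h.trans ?_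
  rw [le_div_iff₀ (by positivity)]
  have : |ρ - θ| * n = |n * ρ - n * θ| := by
    rw [← mul_sub, abs_mul, abs_of_pos hn']; ring
  have h2 : |n * ρ - n * θ| ≤ Real.pi / 2 :=
    abs_le.2 ⟨by linarith [hθ.2, hρ.1], by linarith [hθ.1, hρ.2]⟩
  linarith

/-! ### The algorithm -/

/-- Output the cosine of the midpoint of a cell, after sampling from one more polynomial to make
the total degree equal to a prescribed number. -/
noncomputable def finish (n k : ℕ) : ℕ → Label → Procedure
  | 0, _ => Procedure.done (Real.cos ((2 * k + 1) * Real.pi / (4 * n)))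
  | b + 1, s => Procedure.sample (Chebyshev.T ℂ ((b + 1 : ℕ) : ℤ)) (amplification b s) fun _ _ =>
      Procedure.done (Real.cos ((2 * k + 1) * Real.pi / (4 * n)))

/-- Starting with the cell `(n, k)`, pass to smaller cells until `lim ≤ n`; on each of them
sample `rep n` times from the Chebyshev polynomial of degree `n`. The total degree is `b`. -/
noncomputable def search (rep : ℕ → ℕ) (lim : ℕ) : ℕ → ℕ → ℕ → ℕ → Label → Procedure
  | 0, n, k, b, s => finish n k b s
  | fuel + 1, n, k, b, s =>
      if lim ≤ n then finish n k b s
      else batch (n - 1) (rep n) s fun h s' =>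
        search rep lim fuel (subcell n k (rep n) h).1 (subcell n k (rep n) h).2
          (b - n * rep n) s'

lemma samplesPolynomialsFrom_finish (n k b : ℕ) (s : Label) :
    Procedure.SamplesPolynomialsFrom.{u} (finish n k b s) s := by
  cases b with
  | zero => trivial
  | succ b => exact samplesPolynomialsFrom_sample_chebyshev b s fun _ _ => trivial

lemma onlySemiPellian_finish (n k b : ℕ) (s : Label) : (finish n k b s).OnlySemiPellian := by
  cases b with
  | zero => trivial
  | succ b => exact ⟨rfl, fun _ _ => trivial⟩

lemma conforms_finish {n : ℕ} (hn : 1 ≤ n) (k b : ℕ) (s : Label) :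
    (finish n k b s).Conforms (Real.cos '' cell n k) b := by
  have h : Real.cos ((2 * k + 1) * Real.pi / (4 * n)) ∈ Real.cos '' cell n k := by
    have hn' : (0 : ℝ) < n := by exact_mod_cast hn
    have e : n * ((2 * k + 1) * Real.pi / (4 * n)) = (2 * k + 1) * Real.pi / 4 := by
      field_simp
    refine ⟨_, ⟨?_, ?_⟩, rfl⟩
    · rw [e]; linarith [Real.pi_pos]
    · rw [e]; linarith [Real.pi_pos]
  cases b with
  | zero => exact ⟨h, rfl⟩
  | succ b =>
    refine ⟨?_, ?_, fun _ _ => ⟨h, ?_⟩⟩ <;> rw [natDegree_chebyshev]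
    · omega
    · omega

lemma samplesPolynomialsFrom_search (rep : ℕ → ℕ) (lim fuel n k b : ℕ) (s : Label) :
    Procedure.SamplesPolynomialsFrom.{u} (search rep lim fuel n k b s) s := by
  induction fuel generalizing n k b s with
  | zero => exact samplesPolynomialsFrom_finish n k b s
  | succ fuel ih =>
    rw [search]
    split_ifs
    · exact samplesPolynomialsFrom_finish n k b s
    · exact samplesPolynomialsFrom_batch _ _ _ fun h s => ih _ _ _ _

lemma onlySemiPellian_search (rep : ℕ → ℕ) (lim fuel n k b : ℕ) (s : Label) :
    (search rep lim fuel n k b s).OnlySemiPellian := by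
  induction fuel generalizing n k b s with
  | zero => exact onlySemiPellian_finish n k b s
  | succ fuel ih =>
    rw [search]
    split_ifs
    · exact onlySemiPellian_finish n k b s
    · exact onlySemiPellian_batch _ _ _ fun h s => ih _ _ _ _

/-! ### Recursions for the degree and the error of the search -/

section Analysis

variable {rep : ℕ → ℕ} {lim : ℕ} {Φ : ℕ → ℝ}

/-- The invariant `Φ n < b + 1` says that the remaining degree b is at least the floor of the
potential. It guarantees that the natural subtraction in `search` never truncates. -/
lemma budget_subcell (hΦ0 : ∀ n, 0 ≤ Φ n)
    (hΦ : ∀ n, 1 ≤ n → n < lim → ∀ n', n' = 2 * n ∨ n' = 3 * n → n * rep n + Φ n' ≤ Φ n)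
    {n b : ℕ} (hn : 1 ≤ n) (hlim : n < lim) (hb : Φ n < b + 1) :
    n * rep n ≤ b ∧ ∀ n', n' = 2 * n ∨ n' = 3 * n → Φ n' < (b - n * rep n : ℕ) + 1 := by
  have h1 : n * rep n ≤ b := by
    have h2 := hΦ n hn hlim _ (Or.inl rfl)
    have h3 : ((n * rep n : ℕ) : ℝ) < ((b + 1 : ℕ) : ℝ) := by
      push_cast; linarith [hΦ0 (2 * n)]
    exact Nat.lt_succ_iff.1 (by exact_mod_cast h3)
  refine ⟨h1, fun n' hn' => ?_⟩
  rw [Nat.cast_sub h1]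
  push_cast
  linarith [hΦ n hn hlim n' hn']

lemma conforms_search (hΦ0 : ∀ n, 0 ≤ Φ n)
    (hΦ : ∀ n, 1 ≤ n → n < lim → ∀ n', n' = 2 * n ∨ n' = 3 * n → n * rep n + Φ n' ≤ Φ n)
    (fuel : ℕ) {n : ℕ} (hn : 1 ≤ n) (k : ℕ) {b : ℕ} (hb : Φ n < b + 1) (s : Label) :
    (search rep lim fuel n k b s).Conforms (Real.cos '' cell n k) b := by
  induction fuel generalizing n k b s with
  | zero => exact conforms_finish hn k b s
  | succ fuel ih =>
    rw [search]
    split_ifs with hlim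
    · exact conforms_finish hn k b s
    · obtain ⟨h1, h2⟩ := budget_subcell hΦ0 hΦ hn (not_le.1 hlim) hb
      have e : b = (n - 1 + 1) * rep n + (b - n * rep n) := by
        rw [Nat.sub_add_cancel hn]; omega
      have key : (batch (n - 1) (rep n) s fun h s' => search rep lim fuel
          (subcell n k (rep n) h).1 (subcell n k (rep n) h).2 (b - n * rep n) s').Conforms
          (Real.cos '' cell n k) ((n - 1 + 1) * rep n + (b - n * rep n)) := by
        refine conforms_batch _ _ _ fun h s => ?_
        have hc := subcell_fst n k (rep n) h
        exact (ih (by omega) _ (h2 _ hc) s).mono (Set.image_mono (cell_subcell_subset n k _ h))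
      rwa [← e] at key

/-- `w n` bounds the loss of any output from a level-n cell that contains θ, `V n` the expected loss
from there on. A batch either passes to a correct subcell, with expected loss at most `V n'`, or
errs, with loss at most `w n` and probability at most 2exp(−rep/256); `hstep` balances the two. -/
lemma expect_search_le (hΦ0 : ∀ n, 0 ≤ Φ n)
    (hΦ : ∀ n, 1 ≤ n → n < lim → ∀ n', n' = 2 * n ∨ n' = 3 * n → n * rep n + Φ n' ≤ Φ n)
    {H : Type u} [NormedAddCommGroup H] [InnerProductSpace ℂ H] (I : Instance H)
    {g : ℝ → ℝ} {V w : ℕ → ℝ} (hV0 : ∀ n, 0 ≤ V n) (hw0 : ∀ n, 0 ≤ w n)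
    (hg : ∀ n : ℕ, 1 ≤ n → ∀ r : ℝ, |r - I.amplitude| ≤ Real.pi / (2 * n) → g r ≤ w n)
    (hterminal : ∀ n, 1 ≤ n → lim ≤ n → w n ≤ V n)
    (hstep : ∀ n, 1 ≤ n → n < lim → ∀ n', n' = 2 * n ∨ n' = 3 * n →
      V n' + w n * (2 * Real.exp (-(rep n / 256))) ≤ V n)
    {fuel n : ℕ} (hn : 1 ≤ n) (hfuel : lim ≤ n + fuel) {k b : ℕ} (hb : Φ n < b + 1)
    (hθ : I.angle ∈ cell n k) {s : Label} {v : H} (hv : v ∈ Submodule.span ℂ {I.vec s}) :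
    (search rep lim fuel n k b s).expect I g v ≤ V n * ‖v‖ ^ 2 := by
  have hgcell : ∀ n k, 1 ≤ n → I.angle ∈ cell n k → ∀ r ∈ Real.cos '' cell n k, g r ≤ w n := by
    rintro n k hn hθ _ ⟨ρ, hρ, rfl⟩
    refine hg n hn _ ?_
    rw [← I.cos_angle]
    exact abs_cos_sub_cos_le_of_mem_cell hn hθ hρ
  have hfinish : ∀ n k b s (v : H), 1 ≤ n → lim ≤ n → I.angle ∈ cell n k →
      (finish n k b s).expect I g v ≤ V n * ‖v‖ ^ 2 := fun n k b s v hn hlim hθ =>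
    ((conforms_finish hn k b s).expect_le I (hgcell n k hn hθ) v).trans
      (mul_le_mul_of_nonneg_right (hterminal n hn hlim) (sq_nonneg _))
  induction fuel generalizing n k b s v with
  | zero => exact hfinish n k b s v hn (by omega) hθ
  | succ fuel ih =>
    rw [search]
    split_ifs with hlim
    · exact hfinish n k b s v hn hlim hθ
    · obtain ⟨-, h2⟩ := budget_subcell hΦ0 hΦ hn (not_le.1 hlim) hb
      classical
      refine (expect_batch_le I g (n - 1) (rep n) s (F := fun h =>
        if I.angle ∈ cell (subcell n k (rep n) h).1 (subcell n k (rep n) h).2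
          then max (V (2 * n)) (V (3 * n)) else w n) (fun h s v hv => ?_) hv).trans ?_
      · have hc := subcell_fst n k (rep n) h
        have hn' : 1 ≤ (subcell n k (rep n) h).1 := by omega
        split_ifs with hmem
        · refine (ih hn' (by omega) (h2 _ hc) hmem hv).trans
            (mul_le_mul_of_nonneg_right ?_ (sq_nonneg _))
          rcases hc with hc | hc <;> rw [hc]
          · exact le_max_left _ _
          · exact le_max_right _ _
        -- After a wrong decision nothing is known about later batches, but every possible output
        -- lies in the old cell, which contains θ.
        · refine Procedure.Conforms.expect_le I (fun r hr => ?_)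
            (conforms_search hΦ0 hΦ fuel hn' _ (h2 _ hc) s) v
          exact hgcell n k hn hθ r (Set.image_mono (cell_subcell_subset n k _ h) hr)
      · refine mul_le_mul_of_nonneg_right ?_ (sq_nonneg _)
        have hcast : ((n - 1 : ℕ) : ℝ) + 1 = n := by
          rw [Nat.cast_sub hn]; simp
        rw [hcast]
        refine (binExp_le_of_deviation (sq_nonneg _) (Real.cos_sq_le_one _) (rep n)
          (V := max (V (2 * n)) (V (3 * n))) (hw0 n) (fun h hh => ?_) (fun h => ?_)).trans ?_
        · rw [if_pos (mem_cell_subcell hθ hh)]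
        · have := hV0 (2 * n)
          have := le_max_left (V (2 * n)) (V (3 * n))
          have := hw0 n
          split_ifs <;> linarith
        · rcases max_cases (V (2 * n)) (V (3 * n)) with h | h <;> rw [h.1]
          · exact hstep n hn (not_le.1 hlim) _ (Or.inl rfl)
          · exact hstep n hn (not_le.1 hlim) _ (Or.inr rfl)

end Analysis

/-! ### The choice of the parameters -/

section Parameters

/-- The number of samples on a cell of level `n`: fewer and fewer up to the level `N₂`, and
`256 ℓ` more up to the level `N₁`. -/
noncomputable def repetitions (N₁ N₂ l : ℝ) (n : ℕ) : ℕ :=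
  ⌈256 * (4 * √(N₂ / n) + if (n : ℝ) < N₁ then l else 0)⌉₊

/-- A bound for the total degree of all samples from the level `n` on. -/
noncomputable def costBound (N₁ N₂ l : ℝ) (n : ℕ) : ℝ :=
  257 * (12 * max 0 (2 * N₂ - √(n * N₂)) + l * max 0 (3 * N₁ - n))

variable {N₁ N₂ l : ℝ}

lemma costBound_nonneg (hl : 0 ≤ l) (n : ℕ) : 0 ≤ costBound N₁ N₂ l n := by
  unfold costBound
  positivity

/-- Applied with y = N₂/n. A logarithm in place of 4√y would also beat these powers; the square root
is convenient because √(nN₂) still grows geometrically with n. -/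
lemma sq_and_linear_le_exp_four_mul_sqrt {y : ℝ} (hy : 1 ≤ y) :
    4 * y ^ 2 ≤ Real.exp (4 * √y) ∧ 6 * y ≤ Real.exp (4 * √y) := by
  have hs : 1 ≤ √y := Real.one_le_sqrt.2 hy
  have hsq : √y ^ 2 = y := Real.sq_sqrt (by linarith)
  have h := Real.quadratic_le_exp_of_nonneg (x := 2 * √y) (by linarith)
  have e : Real.exp (4 * √y) = Real.exp (2 * √y) ^ 2 := by
    rw [← Real.exp_nat_mul]; ring_nf
  have h' : 2 * y ≤ Real.exp (2 * √y) := by nlinarith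
  rw [e]
  constructor <;> nlinarith

lemma exp_neg_repetitions_le (n : ℕ) : Real.exp (-(repetitions N₁ N₂ l n / 256)) ≤
    Real.exp (-(if (n : ℝ) < N₁ then l else 0)) * Real.exp (-(4 * √(N₂ / n))) := by
  rw [← Real.exp_add]
  have := Nat.le_ceil (256 * (4 * √(N₂ / n) + if (n : ℝ) < N₁ then l else 0))
  exact Real.exp_le_exp.2 (by unfold repetitions; linarith)

/-- For the bias: one power of n/N₂ compensates the loss π/(2n), the other makes the sum geometric.
-/
lemma two_mul_exp_neg_repetitions_le_sq (hl : 0 ≤ l) {n : ℕ} (hn : 1 ≤ n) (hlt : (n : ℝ) < N₂) :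
    2 * Real.exp (-(repetitions N₁ N₂ l n / 256)) ≤ (n / N₂) ^ 2 := by
  have hn' : (0 : ℝ) < n := by exact_mod_cast hn
  have hN : 0 < N₂ := hn'.trans hlt
  have hy : 1 ≤ N₂ / n := (one_le_div hn').2 hlt.le
  have h := (sq_and_linear_le_exp_four_mul_sqrt hy).1
  have h1 : Real.exp (-(if (n : ℝ) < N₁ then l else 0)) ≤ 1 := by
    rw [Real.exp_le_one_iff]; split_ifs <;> linarith
  have h2 : Real.exp (-(4 * √(N₂ / n))) ≤ (n / N₂) ^ 2 / 4 := by
    have e : (n / N₂) ^ 2 / 4 = (4 * (N₂ / n) ^ 2)⁻¹ := by field_simp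
    rw [Real.exp_neg, e]
    exact inv_anti₀ (by positivity) h
  have h3 := (exp_neg_repetitions_le (N₁ := N₁) (N₂ := N₂) (l := l) n).trans
    (mul_le_of_le_one_left (Real.exp_nonneg _) h1)
  nlinarith [sq_nonneg (n / N₂)]

/-- For the tail: the l extra samples give the factor δ, the square root term gives n/N₁, which is
summable over the levels. -/
lemma two_mul_exp_neg_repetitions_le {δ : ℝ} (h₂ : N₁ ≤ N₂) (hδ : 0 < δ)
    (hl : Real.log δ⁻¹ ≤ l) {n : ℕ} (hn : 1 ≤ n) (hlt : (n : ℝ) < N₁) :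
    2 * Real.exp (-(repetitions N₁ N₂ l n / 256)) ≤ δ / 3 * (n / N₁) := by
  have hn' : (0 : ℝ) < n := by exact_mod_cast hn
  have hN : 0 < N₁ := hn'.trans hlt
  have hy : 1 ≤ N₂ / n := (one_le_div hn').2 (hlt.le.trans h₂)
  have h := (sq_and_linear_le_exp_four_mul_sqrt hy).2
  have h1 : Real.exp (-l) ≤ δ := by
    rw [← Real.le_log_iff_exp_le hδ]
    rw [Real.log_inv] at hl
    linarith
  have h2 : Real.exp (-(4 * √(N₂ / n))) ≤ n / N₁ / 6 := by
    have e : n / N₁ / 6 = (6 * (N₁ / n))⁻¹ := by field_simp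
    rw [Real.exp_neg, e]
    refine inv_anti₀ (by positivity) (le_trans ?_ h)
    gcongr
  have h3 := exp_neg_repetitions_le (N₁ := N₁) (N₂ := N₂) (l := l) n
  rw [if_pos hlt] at h3
  have h4 := mul_le_mul h1 h2 (Real.exp_nonneg _) hδ.le
  linarith

/-- Both parts telescope because n at least doubles; since n' ≤ 3n, neither maximum that has to pay
for samples is cut off at 0. Rounding up is absorbed in passing from 256 to 257, as √(N₂/n) ≥ 1. -/
lemma costBound_step (h₁ : 0 < N₁) (h₂ : N₁ ≤ N₂) (hl : 0 ≤ l) {n : ℕ} (hn : 1 ≤ n)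
    (hlt : (n : ℝ) < N₂) {n' : ℕ} (hn' : n' = 2 * n ∨ n' = 3 * n) :
    n * repetitions N₁ N₂ l n + costBound N₁ N₂ l n' ≤ costBound N₁ N₂ l n := by
  have hn0 : (1 : ℝ) ≤ n := by exact_mod_cast hn
  have hN₂ : 0 < N₂ := h₁.trans_le h₂
  have g1 : (2 : ℝ) * n ≤ n' := by rcases hn' with rfl | rfl <;> push_cast <;> linarith
  have g2 : (n' : ℝ) ≤ 3 * n := by rcases hn' with rfl | rfl <;> push_cast <;> linarith
  have hs : 1 ≤ √(N₂ / n) := Real.one_le_sqrt.2 ((one_le_div (by linarith)).2 hlt.le)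
  have hsqrt : n * √(N₂ / n) = √(n * N₂) := by
    have : (n : ℝ) * N₂ = n ^ 2 * (N₂ / n) := by field_simp
    rw [this, Real.sqrt_mul (sq_nonneg _), Real.sqrt_sq (by linarith)]
  have hrep : (repetitions N₁ N₂ l n : ℝ) ≤
      257 * (4 * √(N₂ / n) + if (n : ℝ) < N₁ then l else 0) := by
    have h0 : 0 ≤ (if (n : ℝ) < N₁ then l else 0) := by split_ifs <;> linarith
    have := Nat.ceil_lt_add_one
      (show 0 ≤ 256 * (4 * √(N₂ / n) + if (n : ℝ) < N₁ then l else 0) by positivity)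
    unfold repetitions
    linarith
  have hcost : n * (repetitions N₁ N₂ l n : ℝ) ≤
      257 * (4 * √(n * N₂) + n * if (n : ℝ) < N₁ then l else 0) := by
    have := mul_le_mul_of_nonneg_left hrep (show (0 : ℝ) ≤ n by linarith)
    rw [← hsqrt]
    linarith
  -- As √2 ≥ 4/3, the root grows by at least a third of itself; the weight 12 in `costBound` turns
  -- this third into the required 4.
  have b1 : 4 / 3 * √(n * N₂) ≤ √(n' * N₂) := by
    refine Real.le_sqrt_of_sq_le ?_
    rw [mul_pow, Real.sq_sqrt (by positivity)]
    nlinarith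
  have b2 : √(n' * N₂) ≤ 2 * N₂ := by
    refine Real.sqrt_le_iff.2 ⟨by linarith, ?_⟩
    nlinarith
  have b3 : l * max 0 (3 * N₁ - n') + n * (if (n : ℝ) < N₁ then l else 0) ≤
      l * max 0 (3 * N₁ - n) := by
    split_ifs with hc
    · rw [max_eq_right (by linarith), max_eq_right (by linarith)]
      nlinarith
    · have : max 0 (3 * N₁ - n') ≤ max 0 (3 * N₁ - n) := max_le_max le_rfl (by linarith)
      have := mul_le_mul_of_nonneg_left this hl
      linarith
  unfold costBound
  rw [max_eq_right (show 0 ≤ 2 * N₂ - √(n' * N₂) by linarith),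
    max_eq_right (show 0 ≤ 2 * N₂ - √(n * N₂) by linarith [Real.sqrt_nonneg (n * N₂)])]
  linarith

end Parameters

/-! ### Tail, mean error and cost for the chosen parameters -/

section Main

variable {ε δ N₁ N₂ l : ℝ}
  {H : Type u} [NormedAddCommGroup H] [InnerProductSpace ℂ H] (I : Instance H)

lemma angle_mem_cell_one_zero : I.angle ∈ cell 1 0 := by
  constructor
  · simpa using I.angle_nonneg
  · simpa using I.angle_le

/-- The potential (δ/3)(3 − n/N₁) drops by at least (δ/3)(n/N₁) when n doubles or triples below N₁,
which pays for the error probability of that level. -/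
lemma expect_deviation_le (hε : 0 < ε) (hδ : 0 < δ) (h₁ : N₁ = Real.pi / ε) (h₂ : N₁ ≤ N₂)
    (hl : 0 ≤ l) (hlδ : Real.log δ⁻¹ ≤ l) {b : ℕ} (hb : costBound N₁ N₂ l 1 < b + 1) :
    (search (repetitions N₁ N₂ l) ⌈N₂⌉₊ ⌈N₂⌉₊ 1 0 b Label.psi).expect I
      ({r | ε ≤ |r - I.amplitude|}.indicator fun _ => 1) I.ψ ≤ δ := by
  have hN₁ : 0 < N₁ := h₁ ▸ div_pos Real.pi_pos hε
  have h := expect_search_le (costBound_nonneg hl)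
    (fun n hn hlt n' hn' => costBound_step hN₁ h₂ hl hn (Nat.lt_ceil.1 hlt) hn') I
    (g := {r | ε ≤ |r - I.amplitude|}.indicator fun _ => 1)
    (V := fun n => δ / 3 * max 0 (3 - n / N₁)) (w := fun n => if (n : ℝ) < N₁ then 1 else 0)
    (fun n => by positivity) (fun n => by positivity) (fun n hn r hr => ?_) (fun n hn hlim => ?_)
    (fun n hn hlt n' hn' => ?_) le_rfl (Nat.le_add_left _ _) hb (angle_mem_cell_one_zero I)
    (s := Label.psi) (Submodule.mem_span_singleton_self _)
  · rw [Instance.vec, I.norm_ψ] at h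
    refine h.trans ?_
    have : max 0 (3 - ((1 : ℕ) : ℝ) / N₁) ≤ 3 :=
      max_le (by norm_num) (sub_le_self _ (by positivity))
    nlinarith
  · split_ifs with hc
    · exact Set.indicator_le_self' (fun _ _ => zero_le_one) r
    -- For n ≥ N₁ = π/ε the error is at most π/(2n) ≤ ε/2, so no deviation of size ε is possible.
    · refine le_of_eq (Set.indicator_of_notMem ?_ _)
      have hn' : (0 : ℝ) < n := by exact_mod_cast hn
      rw [Set.mem_ofPred_eq, not_le]
      refine hr.trans_lt ?_
      rw [not_lt, h₁, div_le_iff₀ hε] at hc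
      rw [div_lt_iff₀ (by positivity)]
      nlinarith [Real.pi_pos, mul_pos hn' hε]
  · have : N₁ ≤ n := h₂.trans (Nat.ceil_le.1 hlim)
    rw [if_neg this.not_gt]
    positivity
  · have hn0 : (1 : ℝ) ≤ n := by exact_mod_cast hn
    have g1 : (2 : ℝ) * n ≤ n' := by rcases hn' with rfl | rfl <;> push_cast <;> linarith
    have g2 : (n' : ℝ) ≤ 3 * n := by rcases hn' with rfl | rfl <;> push_cast <;> linarith
    have g3 : 2 * (n / N₁) ≤ n' / N₁ := by
      rw [← mul_div_assoc]; exact div_le_div_of_nonneg_right g1 hN₁.le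
    have g0 : 0 ≤ n / N₁ := by positivity
    split_ifs with hc
    · have q := two_mul_exp_neg_repetitions_le h₂ hδ hlδ hn hc
      have g4 : n' / N₁ ≤ 3 := by rw [div_le_iff₀ hN₁]; linarith
      rw [max_eq_right (by linarith), max_eq_right (by linarith), one_mul]
      nlinarith
    · have : max 0 (3 - n' / N₁) ≤ max 0 (3 - n / N₁) := max_le_max le_rfl (by linarith)
      rw [zero_mul, add_zero]
      exact mul_le_mul_of_nonneg_left this (by positivity)

/-- In the potential the summand 1 is the resolution π/(2N₂) of a final cell, and 3 − n/N₂ collects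
the geometric series of the wrong decisions. -/
lemma expect_abs_sub_le (hN₁ : 0 < N₁) (h₂ : N₁ ≤ N₂)
    (hl : 0 ≤ l) {b : ℕ} (hb : costBound N₁ N₂ l 1 < b + 1) :
    (search (repetitions N₁ N₂ l) ⌈N₂⌉₊ ⌈N₂⌉₊ 1 0 b Label.psi).expect I
      (fun r => |r - I.amplitude|) I.ψ ≤ 2 * Real.pi / N₂ := by
  have hN₂ : 0 < N₂ := hN₁.trans_le h₂
  have hπ := Real.pi_pos
  have h := expect_search_le (costBound_nonneg hl)
    (fun n hn hlt n' hn' => costBound_step hN₁ h₂ hl hn (Nat.lt_ceil.1 hlt) hn') I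
    (g := fun r => |r - I.amplitude|)
    (V := fun n => Real.pi / 2 / N₂ * (1 + max 0 (3 - n / N₂)))
    (w := fun n => Real.pi / (2 * n))
    (fun n => by positivity) (fun n => by positivity) (fun n hn r hr => hr) (fun n hn hlim => ?_)
    (fun n hn hlt n' hn' => ?_) le_rfl (Nat.le_add_left _ _) hb (angle_mem_cell_one_zero I)
    (s := Label.psi) (Submodule.mem_span_singleton_self _)
  · rw [Instance.vec, I.norm_ψ] at h
    refine h.trans ?_
    have : max 0 (3 - ((1 : ℕ) : ℝ) / N₂) ≤ 3 :=
      max_le (by norm_num) (sub_le_self _ (by positivity))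
    have e : 2 * Real.pi / N₂ = Real.pi / 2 / N₂ * 4 := by ring
    rw [one_pow, mul_one, e]
    exact mul_le_mul_of_nonneg_left (by linarith) (by positivity)
  · have h1 : N₂ ≤ n := Nat.ceil_le.1 hlim
    rw [← div_div]
    refine (div_le_div_of_nonneg_left (by positivity) hN₂ h1).trans ?_
    exact le_mul_of_one_le_right (by positivity) (le_add_of_nonneg_right (le_max_left _ _))
  · have hn0 : (1 : ℝ) ≤ n := by exact_mod_cast hn
    have hc := Nat.lt_ceil.1 hlt
    have g1 : (2 : ℝ) * n ≤ n' := by rcases hn' with rfl | rfl <;> push_cast <;> linarith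
    have g2 : (n' : ℝ) ≤ 3 * n := by rcases hn' with rfl | rfl <;> push_cast <;> linarith
    have g3 : 2 * (n / N₂) ≤ n' / N₂ := by
      rw [← mul_div_assoc]; exact div_le_div_of_nonneg_right g1 hN₂.le
    have g0 : 0 ≤ n / N₂ := by positivity
    have g4 : n' / N₂ ≤ 3 := by rw [div_le_iff₀ hN₂]; linarith
    have q := mul_le_mul_of_nonneg_left (two_mul_exp_neg_repetitions_le_sq (N₁ := N₁) hl hn hc)
      (show 0 ≤ Real.pi / (2 * n) by positivity)
    have e : Real.pi / (2 * n) * (n / N₂) ^ 2 = Real.pi / 2 / N₂ * (n / N₂) := by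
      field_simp
    rw [e] at q
    rw [max_eq_right (by linarith), max_eq_right (by linarith)]
    have := mul_le_mul_of_nonneg_left
      (show 1 + (3 - n' / N₂) + n / N₂ ≤ 1 + (3 - n / N₂) by linarith)
      (show 0 ≤ Real.pi / 2 / N₂ by positivity)
    linarith

lemma costBound_one_le {l : ℝ} {ε η : ℝ} (hε : 0 < ε) (hη : 0 < η) (hl : Real.log 2 ≤ l) :
    costBound (Real.pi / ε) (2 * Real.pi / ε * max 1 η⁻¹) l 1 ≤
      411200 / 4 * (ε⁻¹ * (l + η⁻¹)) := by
  -- The lower bound log 2 for l lets the constant 1 in max(1, 1/η) be absorbed into l.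
  have hl2 : 1 ≤ 2 * l := by linarith [Real.log_two_gt_d9]
  have hη' : 0 < η⁻¹ := inv_pos.2 hη
  have hε' : 0 < ε⁻¹ := inv_pos.2 hε
  have hπ := Real.pi_pos
  have hN : 0 ≤ 2 * Real.pi / ε * max 1 η⁻¹ := by positivity
  have m1 : max 0 (2 * (2 * Real.pi / ε * max 1 η⁻¹) -
      √(((1 : ℕ) : ℝ) * (2 * Real.pi / ε * max 1 η⁻¹))) ≤
      16 * (ε⁻¹ * (2 * l + η⁻¹)) := by
    have hmax : max 1 η⁻¹ ≤ 2 * l + η⁻¹ := max_le (by linarith) (by linarith)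
    have h1 : 2 * (2 * Real.pi / ε * max 1 η⁻¹) ≤ 16 * (ε⁻¹ * (2 * l + η⁻¹)) := by
      have : 2 * (2 * Real.pi / ε * max 1 η⁻¹) = 4 * Real.pi * (ε⁻¹ * max 1 η⁻¹) := by
        rw [div_eq_mul_inv]; ring
      rw [this]
      exact mul_le_mul (by linarith [Real.pi_le_four]) (mul_le_mul_of_nonneg_left hmax hε'.le)
        (by positivity) (by norm_num)
    exact max_le (hN.trans (by linarith)) ((sub_le_self _ (Real.sqrt_nonneg _)).trans h1)
  have m2 : max 0 (3 * (Real.pi / ε) - ((1 : ℕ) : ℝ)) ≤ 12 * ε⁻¹ := by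
    have : 3 * (Real.pi / ε) ≤ 12 * ε⁻¹ := by
      rw [div_eq_mul_inv, ← mul_assoc]
      exact mul_le_mul_of_nonneg_right (by linarith [Real.pi_le_four]) hε'.le
    refine max_le (by positivity) ?_
    push_cast
    linarith
  have m3 := mul_le_mul_of_nonneg_left m2 (show 0 ≤ l by linarith)
  have := mul_pos hε' hη'
  have := mul_pos hε' (show 0 < l by linarith)
  unfold costBound
  nlinarith

end Main

end AmpEst

theorem theorem3 :
    ∃ C : ℝ, 0 < C ∧ ∀ ε δ η : ℝ, 0 < ε → 0 < δ → 0 < η →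
      ∃ (A : AmpEst.Procedure) (D : ℕ),
        AmpEst.Procedure.IsAmplitudeEstimationAlgorithm.{u} A ∧
        A.OnlySemiPellian ∧
        (D : ℝ) ≤ C * (ε⁻¹ * (max (Real.log δ⁻¹) (Real.log 2) + η⁻¹)) ∧
        ∀ (H : Type u) [NormedAddCommGroup H] [InnerProductSpace ℂ H] (I : AmpEst.Instance H),
          IsProbabilityMeasure (A.law I) ∧
          A.law I {r | ε ≤ |r.estimate - I.amplitude|} ≤ ENNReal.ofReal δ ∧
          (∀ᵐ r ∂(A.law I), r.degree = D) ∧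
          (∀ᵐ r ∂(A.law I),
            (r.queries : ℝ) ≤ C * (ε⁻¹ * (max (Real.log δ⁻¹) (Real.log 2) + η⁻¹))) ∧
          Integrable (fun r : AmpEst.Outcome => r.estimate) (A.law I) ∧
          |(∫ r, r.estimate ∂(A.law I)) - I.amplitude| ≤ ε * η + δ := by
  -- Four times the constant for the degree, because the queries are bounded by four times the
  -- degree.
  refine ⟨411200, by norm_num, fun ε δ η hε hδ hη => ?_⟩
  set l := max (Real.log δ⁻¹) (Real.log 2) with hl
  have hl2 : Real.log 2 ≤ l := le_max_right _ _
  have hl0 : 0 ≤ l := (Real.log_nonneg one_le_two).trans hl2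
  set N₁ := Real.pi / ε with hN₁
  -- Makes 2π/N₂ ≤ εη, while the maximum with 1 ensures N₁ ≤ N₂.
  set N₂ := 2 * Real.pi / ε * max 1 η⁻¹ with hN₂
  have hN₁pos : 0 < N₁ := div_pos Real.pi_pos hε
  have h₂ : N₁ ≤ N₂ := by
    have h1 : N₁ * 1 ≤ 2 * N₁ * max 1 η⁻¹ :=
      mul_le_mul (by linarith) (le_max_left _ _) zero_le_one (by linarith)
    rw [mul_one] at h1
    rw [hN₂, mul_div_assoc]
    exact h1
  have hcost := AmpEst.costBound_one_le hε hη hl2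
  rw [← hN₁, ← hN₂] at hcost
  have hc0 := AmpEst.costBound_nonneg (N₁ := N₁) (N₂ := N₂) hl0 1
  set D := ⌊AmpEst.costBound N₁ N₂ l 1⌋₊ with hD
  have hDle : (D : ℝ) ≤ AmpEst.costBound N₁ N₂ l 1 := Nat.floor_le hc0
  have hb : AmpEst.costBound N₁ N₂ l 1 < D + 1 := Nat.lt_floor_add_one _
  set A := AmpEst.search (AmpEst.repetitions N₁ N₂ l) ⌈N₂⌉₊ ⌈N₂⌉₊ 1 0 D AmpEst.Label.psi with hA
  have halg := AmpEst.samplesPolynomialsFrom_search.{u} (AmpEst.repetitions N₁ N₂ l) ⌈N₂⌉₊ ⌈N₂⌉₊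
    1 0 D AmpEst.Label.psi
  refine ⟨A, D, halg, AmpEst.onlySemiPellian_search _ _ _ _ _ _ _,
    by linarith, fun H _ _ I => ?_⟩
  have hconf := AmpEst.conforms_search (AmpEst.costBound_nonneg hl0)
    (fun n hn hlt n' hn' => AmpEst.costBound_step hN₁pos h₂ hl0 hn (Nat.lt_ceil.1 hlt) hn')
    ⌈N₂⌉₊ le_rfl 0 hb AmpEst.Label.psi
  have hae := hconf.ae_lawFrom I halg I.ψ 0 0
  have hprob := A.isProbabilityMeasure_law I
  have hint : Integrable (fun r : AmpEst.Outcome => r.estimate) (A.law I) := by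
    refine Integrable.of_bound measurable_from_top.aestronglyMeasurable 1 ?_
    filter_upwards [hae] with r hr
    obtain ⟨ρ, -, hρ⟩ := hr.1
    rw [← hρ]
    exact Real.abs_cos_le_one ρ
  refine ⟨hprob, ?_, ?_, ?_, hint, ?_⟩
  · exact A.law_le_of_expect_le I
      (AmpEst.expect_deviation_le I hε hδ hN₁ h₂ hl0 (le_max_left _ _) hb)
  · filter_upwards [hae] with r hr
    simpa using hr.2.1
  · filter_upwards [hae] with r hr
    have : (r.queries : ℝ) ≤ ((0 + 4 * D : ℕ) : ℝ) := by exact_mod_cast hr.2.2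
    push_cast at this
    linarith
  · refine A.abs_integral_sub_le I (by positivity) hint
      ((AmpEst.expect_abs_sub_le I hN₁pos h₂ hl0 hb).trans ?_)
    -- The mean absolute error is already at most εη, so the summand δ is not needed.
    have h1 : 2 * Real.pi / N₂ ≤ ε * η := by
      rw [div_le_iff₀ (hN₁pos.trans_le h₂), hN₂]
      have h2 : 1 ≤ η * max 1 η⁻¹ := by
        rw [← mul_inv_cancel₀ hη.ne']
        exact mul_le_mul_of_nonneg_left (le_max_right _ _) hη.le
      have e : ε * η * (2 * Real.pi / ε * max 1 η⁻¹) = 2 * Real.pi * (η * max 1 η⁻¹) := by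
        field_simp
      rw [e]
      exact le_mul_of_one_le_right (by positivity) h2
    linarith
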